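/- For an integer $k\ge 2$, a $k$-star is a copy of the complete bipartite graph $K_{1,k}$. A $k$-star decomposition of a graph $G$ is a collection of $k$-stars in $G$ such that each edge of $G$ is in exactly one of them; a partial $k$-star decomposition of $G$ is a collection of $k$-stars in $G$ such that each edge of $G$ is in at most one of them. A partial $k$-star decomposition $\mathcal{D}$ of $K_n$ can be embedded in a $k$-star decomposition of $K_{n+s}$ if, regarding $K_n$ as a subgraph of $K_{n+s}$, there is a $k$-star decomposition $\mathcal{B}$ of $K_{n+s}$ with $\mathcal{D}\subseteq\mathcal{B}$. Theorem. Let $k\ge 2$ and $n\ge 1$ be integers. Any partial $k$-star decomposition of $K_n$ can be embedded in a $k$-star decomposition of $K_{n+s}$ for some integer $s\ge 0$ such that $s<\frac94 k$ if $k$ is odd and $s<(6-2\sqrt2)k$ if $k$ is even. Moreover, neither constant can be decreased. For each real $c<\frac94$ there are infinitely many odd $k\ge 2$ for which there exist an integer $n\ge 1$ and a partial $k$-star decomposition of $K_n$ that cannot be embedded in a $k$-star decomposition of $K_{n+s}$ for any integer $s\ge 0$ with $s<ck$. For each real $c<6-2\sqrt2$ there are infinitely many even $k\ge 2$ for which there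 exist such an $n$ and such a partial $k$-star decomposition of $K_n$. -/

import Mathlib

/-- A `k`-star with vertices in `V`, i.e. a copy of the complete bipartite graph `K_{1,k}`, given by
its centre and its set of `k` leaves. (For `k ≥ 2` the centre and the leaves are determined by the
copy.) -/
@[ext]
structure StarCopy (V : Type*) (k : ℕ) where
  center : V
  leaves : Finset V
  card_leaves : leaves.card = k
  center_notMem : center ∉ leaves

namespace StarCopy

/-- The edges of a `k`-star: the pairs consisting of the centre and a leaf. -/
def edgeSet {V : Type*} {k : ℕ} (S : StarCopy V k) : Set (Sym2 V) :=
  {e | ∃ v ∈ S.leaves, e = s(S.center, v)}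

/-- The image of a `k`-star under an injection of its vertices. -/
def map {V W : Type*} {k : ℕ} (f : V ↪ W) (S : StarCopy V k) : StarCopy W k where
  center := f S.center
  leaves := S.leaves.map f
  card_leaves := by rw [Finset.card_map, S.card_leaves]
  center_notMem := by
    rw [Finset.mem_map' f]
    exact S.center_notMem

end StarCopy

/-- A partial `k`-star decomposition of `G`: a collection of `k`-stars in `G` such that each edge of
`G` is in at most one of them. -/
def IsPartialStarDecomposition {V : Type*} {k : ℕ} (G : SimpleGraph V) (D : Set (StarCopy V k)) :
    Prop :=
  (∀ S ∈ D, S.edgeSet ⊆ G.edgeSet) ∧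
    ∀ S ∈ D, ∀ T ∈ D, S ≠ T → Disjoint S.edgeSet T.edgeSet

/-- A `k`-star decomposition of `G`: a collection of `k`-stars in `G` such that each edge of `G` is
in exactly one of them. -/
def IsStarDecomposition {V : Type*} {k : ℕ} (G : SimpleGraph V) (D : Set (StarCopy V k)) : Prop :=
  (∀ S ∈ D, S.edgeSet ⊆ G.edgeSet) ∧ ∀ e ∈ G.edgeSet, ∃! S, S ∈ D ∧ e ∈ S.edgeSet

/-- The collection `D` of `k`-stars in `K_n` can be embedded in a `k`-star decomposition of
`K_{n+s}`: some `k`-star decomposition of `K_{n+s}` contains every star of `D`. Here `K_m` is the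
complete graph on `Fin m`, and `K_n` is the subgraph of `K_{n+s}` induced by the first `n`
vertices. -/
def EmbedsInDecomposition {k n : ℕ} (D : Set (StarCopy (Fin n) k)) (s : ℕ) : Prop :=
  ∃ B : Set (StarCopy (Fin (n + s)) k),
    IsStarDecomposition (⊤ : SimpleGraph (Fin (n + s))) B ∧
      ∀ S ∈ D, S.map (Fin.castAddEmb s) ∈ B

open Finset

/-! By Hall's theorem, a graph with `k * ∑ γ v` edges has a decomposition with `γ v` stars centred
at each `v` as soon as every vertex set `T` spans at most `k * ∑ v ∈ T, γ v` edges. Embedding `D`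
amounts to choosing such a `γ` for the leave of `D` in `K_{n+s}`, where `n + s` is taken to be 1
modulo `k` (odd `k`) or modulo `2k`.

If `n + s ≥ 4k + 1`, the stars are spread so evenly that Hall's condition reduces to `s(2k - s) ≤
2n(s - k)`. For `n + s = 4k + 1` this is, up to a linear term, `s² - 8ks + 8k² ≤ 0`, which starts to
hold at `s = (4 - 2√2)k`. For odd `k` the order `3k + 1` occurs too. There the obstacle is that `D`
may contain too many stars, and `s ≥ 5k/4` forces `2 * #D ≤ 3k + 1`. Adding the period to the start
of the window gives 5/4 + 1 = 9/4 and (4 - 2√2) + 2 = 6 - 2√2.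

For sharpness, two vertices that are not centres of new stars must be joined by an edge of `D`. If
the leave of `D` has no large independent set, almost every vertex needs a new star, so `#D` can
hardly exceed `M - (n + s)`, where `M` is the total number of stars. When `k` is prime, or a power
of 2, divisibility forces `n + s ≤ 3k + 1`, or `n + s ≤ 4k + 1`, which caps this excess near `3k/2`,
or `4k`. Suitable `D` on about `7k/4`, or `2√2 k`, vertices exceed the cap. -/

open Classical in
/-- The number of neighbours of `v` in `T`. -/
noncomputable def adjCount {V : Type*} (G : SimpleGraph V) (v : V) (T : Finset V) : ℕ :=
  #{w ∈ T | G.Adj v w}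

/-! ### Counting edges inside and around a vertex set -/

section adjCount

variable {V : Type*} (G : SimpleGraph V)

theorem adjCount_add_compl [Fintype V] [DecidableEq V] (v : V) (T : Finset V) :
    adjCount G v T + adjCount G v Tᶜ = adjCount G v univ := by
  classical
  unfold adjCount
  rw [← card_union_of_disjoint (disjoint_filter_filter disjoint_compl_right), ← filter_union,
    union_compl]

theorem sum_adjCount_comm (A B : Finset V) :
    ∑ v ∈ A, adjCount G v B = ∑ v ∈ B, adjCount G v A := by
  classical
  unfold adjCount
  simp_rw [card_filter]
  rw [sum_comm]
  simp_rw [G.adj_comm]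

theorem adjCount_le (v : V) (T : Finset V) : adjCount G v T ≤ #T := by
  classical
  exact card_filter_le _ _

theorem adjCount_mono (v : V) {S T : Finset V} (h : S ⊆ T) : adjCount G v S ≤ adjCount G v T := by
  classical
  exact card_le_card (filter_subset_filter _ h)

theorem adjCount_add_one_le {v : V} {T : Finset V} (hv : v ∈ T) : adjCount G v T + 1 ≤ #T := by
  classical
  unfold adjCount
  have : {w ∈ T | G.Adj v w} ⊆ T.erase v := fun w hw => by
    rw [mem_filter] at hw
    exact mem_erase.2 ⟨hw.2.ne', hw.1⟩
  have h := card_le_card this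
  rw [card_erase_of_mem hv] at h
  have : 0 < #T := card_pos.2 ⟨v, hv⟩
  omega

theorem adjCount_of_forall {v : V} {T : Finset V} (h : ∀ w ∈ T, w ≠ v → G.Adj v w) (hv : v ∈ T) :
    adjCount G v T + 1 = #T := by
  classical
  unfold adjCount
  have : {w ∈ T | G.Adj v w} = T.erase v := by
    ext w
    simp only [mem_filter, mem_erase]
    exact ⟨fun hw => ⟨hw.2.ne', hw.1⟩, fun hw => ⟨hw.2, h w hw.2 hw.1⟩⟩
  rw [this, card_erase_add_one hv]

theorem adjCount_of_forall_mem {v : V} {T : Finset V} (h : ∀ w ∈ T, G.Adj v w) :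
    adjCount G v T = #T := by
  classical
  unfold adjCount
  rw [filter_true_of_mem h]

theorem sum_adjCount_add [Fintype V] [DecidableEq V] (T : Finset V) :
    ∑ v ∈ T, (adjCount G v univ + adjCount G v Tᶜ) + ∑ v ∈ Tᶜ, adjCount G v Tᶜ =
      ∑ v, adjCount G v univ := by
  have h1 : ∑ v ∈ Tᶜ, adjCount G v univ =
      ∑ v ∈ Tᶜ, adjCount G v T + ∑ v ∈ Tᶜ, adjCount G v Tᶜ := by
    rw [← sum_add_distrib]
    exact sum_congr rfl fun v _ => (adjCount_add_compl G v T).symm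
  rw [sum_add_distrib, ← sum_add_sum_compl T, h1, sum_adjCount_comm G T Tᶜ]
  ring

/-- Twice the number of edges meeting `T`. -/
theorem two_mul_card_biUnion_incidenceFinset [Fintype V] [DecidableEq V] [DecidableRel G.Adj]
    (T : Finset V) :
    2 * #(T.biUnion fun v => G.incidenceFinset v) =
      ∑ v ∈ T, (adjCount G v univ + adjCount G v Tᶜ) := by
  classical
  let H : SimpleGraph V :=
    { Adj := fun u v => G.Adj u v ∧ (u ∈ T ∨ v ∈ T)
      symm := ⟨fun u v h => ⟨h.1.symm, h.2.symm⟩⟩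
      loopless := ⟨fun u h => h.1.ne rfl⟩ }
  have hE : T.biUnion (fun v => G.incidenceFinset v) = H.edgeFinset := by
    ext e
    induction e with
    | _ u v =>
      simp only [mem_biUnion, SimpleGraph.mem_incidenceFinset, SimpleGraph.mem_edgeFinset,
        SimpleGraph.mem_edgeSet, SimpleGraph.mk'_mem_incidenceSet_iff, H]
      constructor
      · rintro ⟨a, ha, h, rfl | rfl⟩
        exacts [⟨h, Or.inl ha⟩, ⟨h, Or.inr ha⟩]
      · rintro ⟨h, h' | h'⟩
        exacts [⟨u, h', h, Or.inl rfl⟩, ⟨v, h', h, Or.inr rfl⟩]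
  rw [hE, ← H.sum_degrees_eq_twice_card_edges, ← sum_add_sum_compl T, sum_add_distrib,
    sum_adjCount_comm G T Tᶜ]
  congr 1 <;> refine sum_congr rfl fun v hv => ?_
  · rw [← SimpleGraph.card_neighborFinset_eq_degree, adjCount]
    congr 1
    ext w
    simp [H, hv]
  · rw [← SimpleGraph.card_neighborFinset_eq_degree, adjCount]
    congr 1
    ext w
    rw [mem_compl] at hv
    simp [H, hv, and_comm]

end adjCount

/-! ### Star packings with prescribed centres, by Hall's theorem -/

section packing

variable {V : Type*} [Fintype V] [DecidableEq V] {k : ℕ}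

/-- By Hall's theorem, there is a packing of `G` with `γ v` stars centred at each vertex `v` if, for
each set `T` of vertices, enough edges meet `T`. -/
theorem exists_star_packing (G : SimpleGraph V) (γ : V → ℕ)
    (h : ∀ T : Finset V, 2 * (k * ∑ v ∈ T, γ v) ≤
      ∑ v ∈ T, (adjCount G v univ + adjCount G v Tᶜ)) :
    ∃ st : (Σ v, Fin (γ v)) → StarCopy V k, (∀ x, (st x).center = x.1) ∧
      (∀ x, (st x).edgeSet ⊆ G.edgeSet) ∧
      (∀ x y, x ≠ y → Disjoint (st x).edgeSet (st y).edgeSet) ∧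
      (2 * (k * ∑ v, γ v) = ∑ v, adjCount G v univ → ∀ e ∈ G.edgeSet, ∃ x, e ∈ (st x).edgeSet) := by
  classical
  -- Each star is cut into `k` slots, and every slot asks for its own edge at the centre. The union
  -- of the sets offered to a family of slots depends only on the set of their centres.
  let t : ((Σ v, Fin (γ v)) × Fin k) → Finset (Sym2 V) := fun i => G.incidenceFinset i.1.1
  have hall : ∀ F : Finset ((Σ v, Fin (γ v)) × Fin k), #F ≤ #(F.biUnion t) := by
    intro F
    let T : Finset V := F.image fun i => i.1.1
    have h1 : F ⊆ (T.sigma fun v => (univ : Finset (Fin (γ v)))) ×ˢ (univ : Finset (Fin k)) := by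
      intro i hi
      simp only [mem_product, mem_sigma, mem_univ, and_true]
      exact mem_image_of_mem (fun i : (Σ v, Fin (γ v)) × Fin k => i.1.1) hi
    have h2 := card_le_card h1
    rw [card_product, card_sigma] at h2
    simp only [card_univ, Fintype.card_fin] at h2
    have h3 : F.biUnion t = T.biUnion fun v => G.incidenceFinset v := by
      rw [image_biUnion]
    have h4 := h T
    rw [← two_mul_card_biUnion_incidenceFinset] at h4
    rw [h3]
    rw [mul_comm] at h2
    omega
  obtain ⟨f, hf, hft⟩ := (all_card_le_biUnion_card_iff_exists_injective t).1 hall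
  have hex : ∀ i, ∃ w, f i = s(i.1.1, w) ∧ G.Adj i.1.1 w := by
    intro i
    have := hft i
    simp only [t, SimpleGraph.mem_incidenceFinset] at this
    obtain ⟨w, hw⟩ := Sym2.mem_iff_exists.1 this.2
    refine ⟨w, hw, ?_⟩
    have h1 := this.1
    rwa [hw] at h1
  choose g hg hadj using hex
  have hinj : ∀ x, Function.Injective fun l => g (x, l) := by
    intro x l l' hl
    have : f (x, l) = f (x, l') := by rw [hg, hg]; exact congrArg (fun a => s(x.1, a)) hl
    simpa using hf this
  let st : (Σ v, Fin (γ v)) → StarCopy V k := fun x =>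
    { center := x.1
      leaves := univ.image fun l => g (x, l)
      card_leaves := by rw [card_image_of_injective _ (hinj x)]; simp
      center_notMem := by
        simp only [mem_image, mem_univ, true_and, not_exists]
        intro l hl
        exact (hadj (x, l)).ne hl.symm }
  have hmem : ∀ x e, e ∈ (st x).edgeSet ↔ ∃ l, e = f (x, l) := by
    intro x e
    simp only [StarCopy.edgeSet, st, Set.mem_ofPred_eq, mem_image, mem_univ, true_and]
    constructor
    · rintro ⟨v, ⟨l, rfl⟩, rfl⟩
      exact ⟨l, (hg (x, l)).symm⟩
    · rintro ⟨l, rfl⟩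
      exact ⟨_, ⟨l, rfl⟩, hg (x, l)⟩
  refine ⟨st, fun x => rfl, ?_, ?_, ?_⟩
  · intro x e he
    obtain ⟨l, rfl⟩ := (hmem x e).1 he
    rw [hg]
    exact hadj (x, l)
  · intro x y hxy
    rw [Set.disjoint_left]
    intro e he he'
    obtain ⟨l, rfl⟩ := (hmem x e).1 he
    obtain ⟨l', hl'⟩ := (hmem y _).1 he'
    exact hxy (congrArg Prod.fst (hf hl'))
  · intro htot e he
    -- When the numbers match, the injection from slots to edges is onto.
    have hsub : univ.image f ⊆ G.edgeFinset := by
      intro e' he'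
      obtain ⟨i, -, rfl⟩ := mem_image.1 he'
      rw [SimpleGraph.mem_edgeFinset, hg]
      exact hadj i
    have hcard : #G.edgeFinset ≤ #(univ.image f) := by
      rw [card_image_of_injective _ hf, card_univ, Fintype.card_prod, Fintype.card_sigma]
      simp only [Fintype.card_fin]
      have h5 := G.sum_degrees_eq_twice_card_edges
      have h6 : ∑ v, adjCount G v univ = ∑ v, G.degree v := by
        refine sum_congr rfl fun v _ => ?_
        rw [← SimpleGraph.card_neighborFinset_eq_degree, adjCount]
        congr 1
        ext w
        simp
      rw [h6, h5] at htot
      rw [mul_comm _ k]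
      omega
    have heq := eq_of_subset_of_card_le hsub hcard
    have : e ∈ univ.image f := by rw [heq]; exact SimpleGraph.mem_edgeFinset.2 he
    obtain ⟨⟨x, l⟩, -, rfl⟩ := mem_image.1 this
    exact ⟨x, (hmem x _).2 ⟨l, rfl⟩⟩

/-- Once the total is exact, enough edges meet `Tᶜ` precisely when not too many lie inside `T`. -/
theorem exists_isStarDecomposition (G : SimpleGraph V) (γ : V → ℕ)
    (htot : 2 * (k * ∑ v, γ v) = ∑ v, adjCount G v univ)
    (h : ∀ T : Finset V, ∑ v ∈ T, adjCount G v T ≤ 2 * (k * ∑ v ∈ T, γ v)) :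
    ∃ B : Set (StarCopy V k), IsStarDecomposition G B := by
  obtain ⟨st, -, hG, hdisj, hcov⟩ := exists_star_packing (k := k) G γ (fun T => by
    have h1 := sum_adjCount_add G T
    have h2 := h Tᶜ
    have h3 := sum_add_sum_compl T γ
    rw [← htot, ← h3] at h1
    simp only [mul_add] at h1
    omega)
  refine ⟨Set.range st, ?_, ?_⟩
  · rintro _ ⟨x, rfl⟩
    exact hG x
  · intro e he
    obtain ⟨x, hx⟩ := hcov htot e he
    refine ⟨st x, ⟨⟨x, rfl⟩, hx⟩, ?_⟩
    rintro _ ⟨⟨y, rfl⟩, hy⟩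
    by_contra hne
    exact Set.disjoint_left.1 (hdisj y x fun hyx => hne (by rw [hyx])) hy hx

end packing

/-! ### Stars, leaves and extensions of partial decompositions -/

theorem StarCopy.mem_edgeSet_iff {V : Type*} {k : ℕ} {S : StarCopy V k} {u v : V} :
    s(u, v) ∈ S.edgeSet ↔ u = S.center ∧ v ∈ S.leaves ∨ v = S.center ∧ u ∈ S.leaves := by
  simp only [StarCopy.edgeSet, Set.mem_ofPred_eq, Sym2.eq_iff]
  constructor
  · rintro ⟨w, hw, ⟨rfl, rfl⟩ | ⟨rfl, rfl⟩⟩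
    exacts [Or.inl ⟨rfl, hw⟩, Or.inr ⟨rfl, hw⟩]
  · rintro (⟨rfl, h⟩ | ⟨rfl, h⟩)
    exacts [⟨v, h, Or.inl ⟨rfl, rfl⟩⟩, ⟨u, h, Or.inr ⟨rfl, rfl⟩⟩]

theorem StarCopy.edgeSet_subset_top {V : Type*} {k : ℕ} (S : StarCopy V k) :
    S.edgeSet ⊆ (⊤ : SimpleGraph V).edgeSet := by
  rintro _ ⟨v, hv, rfl⟩
  rw [SimpleGraph.mem_edgeSet, SimpleGraph.top_adj]
  rintro rfl
  exact S.center_notMem hv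

theorem StarCopy.edgeSet_nonempty {V : Type*} {k : ℕ} (hk : 0 < k) (S : StarCopy V k) :
    S.edgeSet.Nonempty := by
  obtain ⟨v, hv⟩ := card_pos.1 (S.card_leaves.symm ▸ hk)
  exact ⟨_, v, hv, rfl⟩

theorem StarCopy.mk_mem_edgeSet_map {V W : Type*} {k : ℕ} {f : V ↪ W} {S : StarCopy V k} {u v : V} :
    s(f u, f v) ∈ (S.map f).edgeSet ↔ s(u, v) ∈ S.edgeSet := by
  simp [StarCopy.mem_edgeSet_iff, StarCopy.map]

theorem StarCopy.exists_of_mem_edgeSet_map {V W : Type*} {k : ℕ} {f : V ↪ W} {S : StarCopy V k}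
    {e : Sym2 W} (he : e ∈ (S.map f).edgeSet) : ∃ u v, e = s(f u, f v) := by
  obtain ⟨w, hw, rfl⟩ := he
  obtain ⟨v, -, rfl⟩ := mem_map.1 hw
  exact ⟨S.center, v, rfl⟩

theorem StarCopy.map_injective {V W : Type*} {k : ℕ} (f : V ↪ W) :
    Function.Injective (StarCopy.map (k := k) f) := by
  intro S T h
  rw [StarCopy.ext_iff] at h ⊢
  exact ⟨f.injective h.1, Finset.map_injective f h.2⟩

instance {V : Type*} [Finite V] {k : ℕ} : Finite (StarCopy V k) :=
  Finite.of_injective (fun S : StarCopy V k => (S.center, S.leaves)) fun S T h => by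
    rw [Prod.mk.injEq] at h
    exact StarCopy.ext h.1 h.2

/-- The leave of a collection of stars: the graph of all pairs that are in none of them. -/
def leave {V : Type*} {k : ℕ} (D : Set (StarCopy V k)) : SimpleGraph V where
  Adj u v := u ≠ v ∧ ∀ S ∈ D, s(u, v) ∉ S.edgeSet
  symm := ⟨fun u v h => ⟨h.1.symm, fun S hS => Sym2.eq_swap (a := u) (b := v) ▸ h.2 S hS⟩⟩
  loopless := ⟨fun _ h => h.1 rfl⟩

theorem leave_adj {V : Type*} {k : ℕ} {D : Set (StarCopy V k)} {u v : V} :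
    (leave D).Adj u v ↔ u ≠ v ∧ ∀ S ∈ D, s(u, v) ∉ S.edgeSet := Iff.rfl

theorem IsStarDecomposition.union {V : Type*} {k : ℕ} {D B : Set (StarCopy V k)}
    (hD : IsPartialStarDecomposition ⊤ D) (hB : IsStarDecomposition (leave D) B) :
    IsStarDecomposition ⊤ (D ∪ B) := by
  refine ⟨fun S _ => S.edgeSet_subset_top, ?_⟩
  intro e he
  by_cases h : ∃ S ∈ D, e ∈ S.edgeSet
  · obtain ⟨S, hS, heS⟩ := h
    refine ⟨S, ⟨Or.inl hS, heS⟩, ?_⟩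
    rintro T ⟨hT | hT, heT⟩
    · by_contra hne
      exact Set.disjoint_left.1 (hD.2 T hT S hS hne) heT heS
    · exfalso
      have := hB.1 T hT heT
      induction e with
      | _ u v => exact (leave_adj.1 this).2 S hS heS
  · push Not at h
    have he' : e ∈ (leave D).edgeSet := by
      induction e with
      | _ u v => exact ⟨he, h⟩
    obtain ⟨S, ⟨hS, heS⟩, huniq⟩ := hB.2 e he'
    refine ⟨S, ⟨Or.inr hS, heS⟩, ?_⟩
    rintro T ⟨hT | hT, heT⟩
    · exact absurd heT (h T hT)
    · exact huniq T ⟨hT, heT⟩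

theorem IsPartialStarDecomposition.map {V W : Type*} {k : ℕ} {D : Set (StarCopy V k)} (f : V ↪ W)
    (hD : IsPartialStarDecomposition ⊤ D) :
    IsPartialStarDecomposition ⊤ (StarCopy.map f '' D) := by
  refine ⟨fun S _ => S.edgeSet_subset_top, ?_⟩
  rintro _ ⟨S, hS, rfl⟩ _ ⟨T, hT, rfl⟩ hne
  rw [Set.disjoint_left]
  intro e he he'
  obtain ⟨u, v, rfl⟩ := StarCopy.exists_of_mem_edgeSet_map he
  rw [StarCopy.mk_mem_edgeSet_map] at he he'
  exact Set.disjoint_left.1 (hD.2 S hS T hT fun h => hne (by rw [h])) he he'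

theorem IsStarDecomposition.isPartial {V : Type*} {k : ℕ} {G : SimpleGraph V}
    {B : Set (StarCopy V k)} (hB : IsStarDecomposition G B) : IsPartialStarDecomposition G B := by
  refine ⟨hB.1, fun S hS T hT hne => Set.disjoint_left.2 fun e heS heT => hne ?_⟩
  exact (hB.2 e (hB.1 S hS heS)).unique ⟨hS, heS⟩ ⟨hT, heT⟩

theorem sum_adjCount_leave {V : Type*} [Fintype V] {k : ℕ} (D : Finset (StarCopy V k))
    (hD : IsPartialStarDecomposition ⊤ (D : Set (StarCopy V k))) :
    ∑ v, adjCount (leave (D : Set (StarCopy V k))) v univ + 2 * (k * #D) =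
      Fintype.card V * (Fintype.card V - 1) := by
  classical
  set G := leave (D : Set (StarCopy V k)) with hG
  have h1 : ∀ v, adjCount G v univ + Gᶜ.degree v = Fintype.card V - 1 := by
    intro v
    have : adjCount G v univ = G.degree v := by
      rw [← SimpleGraph.card_neighborFinset_eq_degree, adjCount]
      congr 1
      ext w
      simp
    rw [this, SimpleGraph.degree_compl]
    have := G.degree_lt_card_verts v
    omega
  let E : StarCopy V k → Finset (Sym2 V) := fun S => S.leaves.image fun v => s(S.center, v)
  have hE : ∀ S e, e ∈ E S ↔ e ∈ S.edgeSet := by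
    intro S e
    simp only [E, mem_image, StarCopy.edgeSet, Set.mem_ofPred_eq]
    exact ⟨fun ⟨v, h, h'⟩ => ⟨v, h, h'.symm⟩, fun ⟨v, h, h'⟩ => ⟨v, h, h'.symm⟩⟩
  have hEc : ∀ S, #(E S) = k := by
    intro S
    rw [card_image_of_injective, S.card_leaves]
    intro a b hab
    exact Sym2.congr_right.1 hab
  have h2 : Gᶜ.edgeFinset = D.biUnion E := by
    ext e
    induction e with
    | _ u v =>
      rw [SimpleGraph.mem_edgeFinset, SimpleGraph.mem_edgeSet, SimpleGraph.compl_adj, hG, leave_adj,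
        mem_biUnion]
      push Not
      simp only [hE]
      constructor
      · rintro ⟨hne, h⟩
        obtain ⟨S, hS, h⟩ := h hne
        exact ⟨S, hS, h⟩
      · rintro ⟨S, hS, h⟩
        exact ⟨by simpa using S.edgeSet_subset_top h, fun _ => ⟨S, hS, h⟩⟩
  have h3 : #Gᶜ.edgeFinset = k * #D := by
    rw [h2, card_biUnion]
    · simp [hEc, mul_comm]
    · intro S hS T hT hne
      refine Finset.disjoint_left.2 fun e he he' => ?_
      exact Set.disjoint_left.1 (hD.2 S hS T hT hne) ((hE S e).1 he) ((hE T e).1 he')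
  rw [← h3, ← SimpleGraph.sum_degrees_eq_twice_card_edges, ← sum_add_distrib,
    sum_congr rfl fun v _ => h1 v]
  simp

/-- A decomposition of the leave of the image of `D` in `K_{n+s}` gives an embedding of `D`. -/
theorem embedsInDecomposition_of_leave {k n s : ℕ} {D : Set (StarCopy (Fin n) k)}
    (hD : IsPartialStarDecomposition ⊤ D)
    (h : ∃ B : Set (StarCopy (Fin (n + s)) k),
      IsStarDecomposition (leave (StarCopy.map (Fin.castAddEmb s) '' D)) B) :
    EmbedsInDecomposition D s := by
  obtain ⟨B, hB⟩ := h
  exact ⟨_, IsStarDecomposition.union (hD.map _) hB, fun S hS => Or.inl ⟨S, hS, rfl⟩⟩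

/-- In a decomposition extending `D`, the vertices that are not the centre of a new star are
pairwise joined by edges of `D`, so there are few of them. -/
theorem EmbedsInDecomposition.exists_card {k n s A : ℕ}
    {D : Finset (StarCopy (Fin n) k)}
    (hA : ∀ T : Finset (Fin n), (∀ u ∈ T, ∀ v ∈ T, u ≠ v →
      ¬ (leave (D : Set (StarCopy (Fin n) k))).Adj u v) → #T ≤ A)
    (h : EmbedsInDecomposition (D : Set (StarCopy (Fin n) k)) s) :
    ∃ M, 2 * (k * M) = (n + s) * (n + s - 1) ∧ n + s + #D ≤ M + A + 1 := by
  classical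
  obtain ⟨B, hB, hDB⟩ := h
  obtain ⟨B, rfl⟩ := (Set.toFinite B).exists_finset_coe
  refine ⟨#B, ?_, ?_⟩
  · have h1 := sum_adjCount_leave B hB.isPartial
    have h2 : ∀ v, adjCount (leave (B : Set (StarCopy (Fin (n + s)) k))) v univ = 0 := by
      intro v
      rw [adjCount, card_eq_zero, filter_eq_empty_iff]
      intro w _ hw
      obtain ⟨S, ⟨hS, hS'⟩, -⟩ := hB.2 s(v, w) (by simpa using hw.ne)
      exact (leave_adj.1 hw).2 S hS hS'
    simp only [h2, sum_const_zero, zero_add, Fintype.card_fin] at h1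
    exact h1
  · let D' := D.image (StarCopy.map (Fin.castAddEmb s))
    have hD' : #D' = #D := card_image_of_injective _ (StarCopy.map_injective _)
    have hsub : D' ⊆ B := by
      intro S hS
      obtain ⟨S', hS', rfl⟩ := mem_image.1 hS
      exact hDB S' hS'
    -- The vertices that are not centres of new stars. There are `#B - #D` new stars, hence at most
    -- that many vertices outside `Z`.
    let Z : Finset (Fin (n + s)) := ((B \ D').image StarCopy.center)ᶜ
    have hZ : n + s ≤ #Z + (#B - #D) := by
      have h1 : #((B \ D').image StarCopy.center) ≤ #B - #D := by
        refine card_image_le.trans ?_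
        rw [card_sdiff_of_subset hsub, hD']
      have h2 := card_compl_add_card ((B \ D').image StarCopy.center)
      rw [Fintype.card_fin] at h2
      change #Z + _ = _ at h2
      omega
    have hBD : #D ≤ #B := hD' ▸ card_le_card hsub
    have hind : ∀ u ∈ Z, ∀ v ∈ Z, u ≠ v → ∃ S ∈ D, s(u, v) ∈ (S.map (Fin.castAddEmb s)).edgeSet := by
      intro u hu v hv huv
      obtain ⟨S, ⟨hS, hS'⟩, -⟩ := hB.2 s(u, v) (by simpa using huv)
      by_cases hSD : S ∈ D'
      · obtain ⟨R, hR, rfl⟩ := mem_image.1 hSD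
        exact ⟨R, hR, hS'⟩
      · exfalso
        simp only [Z, mem_compl, mem_image, mem_sdiff, not_exists, not_and] at hu hv
        rcases StarCopy.mem_edgeSet_iff.1 hS' with h | h
        · exact hu S ⟨hS, hSD⟩ h.1.symm
        · exact hv S ⟨hS, hSD⟩ h.1.symm
    let T : Finset (Fin n) := {i | Fin.castAddEmb s i ∈ Z}
    have hT : #T ≤ A := by
      refine hA T fun u hu v hv huv hadj => ?_
      simp only [T, mem_filter, mem_univ, true_and] at hu hv
      obtain ⟨S, hS, h⟩ := hind _ hu _ hv fun h => huv ((Fin.castAddEmb s).injective h)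
      rw [StarCopy.mk_mem_edgeSet_map] at h
      exact hadj.2 S hS h
    -- Edges of `D` stay inside `K_n`, so two added vertices cannot both be in `Z`. This is the
    -- extra 1 in the bound.
    have hZT : #(Z \ T.map (Fin.castAddEmb s)) ≤ 1 := by
      rw [card_le_one]
      intro u hu v hv
      by_contra huv
      rw [mem_sdiff] at hu hv
      obtain ⟨S, hS, h⟩ := hind _ hu.1 _ hv.1 huv
      obtain ⟨a, b, hab⟩ := StarCopy.exists_of_mem_edgeSet_map h
      have : ∃ a, u = Fin.castAddEmb s a := by
        rcases Sym2.eq_iff.1 hab with h | h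
        exacts [⟨a, h.1⟩, ⟨b, h.1⟩]
      obtain ⟨a, rfl⟩ := this
      refine hu.2 (mem_map_of_mem _ ?_)
      simp only [T, mem_filter, mem_univ, true_and]
      exact hu.1
    have h3 := card_le_card_sdiff_add_card (s := Z) (t := T.map (Fin.castAddEmb s))
    rw [card_map] at h3
    omega

/-! ### Distributing the centres when `K_n` is large -/

/-- A choice of threshold: some `q ≤ r` is the number of elements with `s * a < u * (p + q)`,
unless there are `r` elements with `s * a < u * (p + r)`. -/
theorem exists_card_threshold {α : Type*} (X : Finset α) (a : α → ℤ) (s u p : ℤ) (hu : 0 ≤ u)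
    (r : ℕ) : ∃ q ≤ r, ∃ Q ⊆ X, #Q = q ∧ (∀ v ∈ Q, s * a v < u * (p + q)) ∧
      (q = r ∨ ∀ v ∈ X, v ∉ Q → u * (p + q) ≤ s * a v) := by
  classical
  let F : ℕ → Finset α := fun q => {v ∈ X | s * a v < u * (p + q)}
  -- The least such `q` also satisfies `q ≤ #(F q)`, because `F` is increasing and `q - 1` fails.
  have hex : ∃ q, q = r ∨ #(F q) ≤ q := ⟨r, Or.inl rfl⟩
  have hq := Nat.find_spec hex
  have hle : Nat.find hex ≤ r := Nat.find_min' hex (Or.inl rfl)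
  have hge : Nat.find hex ≤ #(F (Nat.find hex)) := by
    rcases Nat.eq_zero_or_pos (Nat.find hex) with h | h
    · omega
    · have h1 := Nat.find_min hex (Nat.sub_lt h one_pos)
      push Not at h1
      have h2 : F (Nat.find hex - 1) ⊆ F (Nat.find hex) := by
        intro v hv
        simp only [F, mem_filter] at hv ⊢
        refine ⟨hv.1, hv.2.trans_le (mul_le_mul_of_nonneg_left ?_ hu)⟩
        have : ((Nat.find hex - 1 : ℕ) : ℤ) ≤ (Nat.find hex : ℤ) := by exact_mod_cast Nat.sub_le _ _
        linarith
      have h3 := card_le_card h2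
      omega
  obtain ⟨Q, hQ, hQc⟩ := exists_subset_card_eq hge
  refine ⟨Nat.find hex, hle, Q, hQ.trans (filter_subset _ _), hQc, ?_, ?_⟩
  · intro v hv
    exact (mem_filter.1 (hQ hv)).2
  · refine hq.imp_right fun h v hv hvQ => ?_
    have : Q = F (Nat.find hex) := eq_of_subset_of_card_le hQ (by omega)
    rw [this] at hvQ
    simp only [F, mem_filter, not_and, not_lt] at hvQ
    exact hvQ hv

/-- The numbers of stars to be centred at the vertices of `X`, and the numbers `c` (for `p`
vertices) and `c + 1` (for `r` vertices) of stars to be centred at the new vertices. -/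
theorem exists_centre_numbers {α : Type*} (X : Finset α) (ℓ : α → ℕ) {s k : ℕ} (hk : 0 < k)
    (hks : k ≤ s) (hdiv : 2 * (k : ℤ) ∣ s * (s - 1) + 2 * #X * s + ∑ v ∈ X, (ℓ v : ℤ)) :
    ∃ (γ : α → ℕ) (c p r : ℕ), p + r = s ∧ 0 < p ∧
      2 * (k : ℤ) * (∑ v ∈ X, (γ v : ℤ) + c * s + r) =
        s * (s - 1) + 2 * #X * s + ∑ v ∈ X, (ℓ v : ℤ) ∧
      (∀ v ∈ X, 0 ≤ 2 * (k : ℤ) * γ v - ℓ v ∧ 2 * (k : ℤ) * γ v - ℓ v ≤ 2 * s) ∧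
      (r = 0 ∨ 2 * k ≤ s ∨ ∀ v ∈ X, 2 * ((s : ℤ) - k) * p ≤ s * (2 * (k : ℤ) * γ v - ℓ v) ∧
        2 * ((s : ℤ) - k) * r ≤ s * (2 * s - (2 * (k : ℤ) * γ v - ℓ v))) := by
  classical
  -- The least number of stars whose edges exceed `ℓ v / 2`; the doubled surplus `a v` then lies in
  -- `(0, 2k]`.
  let g : α → ℕ := fun v => ℓ v / (2 * k) + 1
  let a : α → ℤ := fun v => 2 * (k : ℤ) * g v - ℓ v
  have ha0 : ∀ v, 0 < a v ∧ a v ≤ 2 * k := by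
    intro v
    have h1 := Nat.div_add_mod (ℓ v) (2 * k)
    have h2 := Nat.mod_lt (ℓ v) (by omega : 2 * k > 0)
    have h3 : (2 * (k : ℤ)) * ((ℓ v / (2 * k) : ℕ) : ℤ) + ((ℓ v % (2 * k) : ℕ) : ℤ) = ℓ v := by
      exact_mod_cast h1
    have h4 : ((ℓ v % (2 * k) : ℕ) : ℤ) < 2 * k := by exact_mod_cast h2
    have h5 : (0 : ℤ) ≤ ((ℓ v % (2 * k) : ℕ) : ℤ) := Nat.cast_nonneg _
    simp only [a, g]
    push_cast [mul_add] at h3 h4 h5 ⊢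
    constructor <;> linarith
  have hsum : ∑ v ∈ X, a v = 2 * (k : ℤ) * ∑ v ∈ X, (g v : ℤ) - ∑ v ∈ X, (ℓ v : ℤ) := by
    rw [sum_sub_distrib, mul_sum]
  have hsum_le : ∑ v ∈ X, a v ≤ #X * (2 * k) := by
    rw [← nsmul_eq_mul]
    exact sum_le_card_nsmul _ _ _ fun v _ => (ha0 v).2
  obtain ⟨m, hm⟩ := hdiv
  have hk' : (0 : ℤ) < 2 * k := by exact_mod_cast (by omega : 0 < 2 * k)
  have hks' : (k : ℤ) ≤ s := by exact_mod_cast hks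
  have hs1 : (1 : ℤ) ≤ s := by exact_mod_cast (by omega : 1 ≤ s)
  have hx0 : 0 ≤ m - ∑ v ∈ X, (g v : ℤ) := by
    refine le_of_mul_le_mul_left ?_ hk'
    have h1 : (#X : ℤ) * (2 * k) ≤ 2 * #X * s := by nlinarith [(Nat.cast_nonneg #X : (0 : ℤ) ≤ #X)]
    have h2 : (0 : ℤ) ≤ s * (s - 1) := mul_nonneg (by linarith) (by linarith)
    rw [mul_zero, mul_sub, ← hm]
    linarith
  obtain ⟨x, hx⟩ := Int.eq_ofNat_of_zero_le hx0
  have hs0 : 0 < s := by omega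
  have hdm := Nat.div_add_mod x s
  have hml := Nat.mod_lt x hs0
  -- The `x` remaining stars are shared evenly among the `s` new vertices.
  set c := x / s with hc
  set r := x % s with hr
  have hxc : (x : ℤ) = c * s + r := by
    rw [← hdm]; push_cast; ring
  have htot : 2 * (k : ℤ) * (∑ v ∈ X, (g v : ℤ) + c * s + r) =
      s * (s - 1) + 2 * #X * s + ∑ v ∈ X, (ℓ v : ℤ) := by
    rw [hm]
    congr 1
    linarith
  by_cases h2k : 2 * k ≤ s
  · refine ⟨g, c, s - r, r, by omega, by omega, htot, fun v _ => ⟨(ha0 v).1.le, ?_⟩,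
      Or.inr (Or.inl h2k)⟩
    exact (ha0 v).2.trans (by exact_mod_cast (by omega : 2 * k ≤ 2 * s))
  have h2k' : (s : ℤ) ≤ 2 * k := by exact_mod_cast (by omega : s ≤ 2 * k)
  have hu : (0 : ℤ) ≤ 2 * (s - k) := by linarith
  -- The `q` vertices of small surplus each take one star from a new vertex that had `c + 1`. This
  -- raises `p` to `s - r + q`, and the threshold depends on `p`, so `q` must be consistent with the
  -- threshold it creates.
  obtain ⟨q, hqr, Q, hQX, hQc, hQ1, hQ2⟩ := exists_card_threshold X a s (2 * (s - k)) (s - r) hu r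
  have hqr' : (q : ℤ) ≤ r := by exact_mod_cast hqr
  have hrs : (r : ℤ) ≤ s := by exact_mod_cast hml.le
  have hp : ((s - r + q : ℕ) : ℤ) = s - r + q := by push_cast [hml.le]; ring
  have hs0' : (0 : ℤ) < s := by linarith
  have hQa : ∀ v ∈ Q, a v < 2 * (s - k) := by
    intro v hv
    have h1 := hQ1 v hv
    refine lt_of_mul_lt_mul_left (h1.trans_le ?_) hs0'.le
    rw [mul_comm (s : ℤ)]
    exact mul_le_mul_of_nonneg_left (by linarith) hu
  have hval : ∀ v, 2 * (k : ℤ) * ((g v + if v ∈ Q then 1 else 0 : ℕ) : ℤ) - ℓ v =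
      a v + if v ∈ Q then 2 * (k : ℤ) else 0 := by
    intro v
    simp only [a]
    split_ifs <;> push_cast <;> ring
  refine ⟨fun v => g v + if v ∈ Q then 1 else 0, c, s - r + q, r - q, by omega, by omega, ?_, ?_, ?_⟩
  · rw [← htot]
    have : ∑ v ∈ X, ((g v + if v ∈ Q then 1 else 0 : ℕ) : ℤ) = ∑ v ∈ X, (g v : ℤ) + q := by
      push_cast
      rw [sum_add_distrib, sum_ite_mem, inter_eq_right.2 hQX]
      simp [hQc]
    rw [this]
    push_cast [hqr]
    ring
  · intro v _
    rw [hval]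
    have h1 := ha0 v
    split_ifs with hv
    · have h2 := hQa v hv
      constructor <;> linarith
    · constructor <;> linarith
  · rcases hQ2 with rfl | hQ2
    · exact Or.inl (by omega)
    · refine Or.inr (Or.inr fun v hv => ?_)
      rw [hval, hp]
      push_cast [hqr]
      have h1 := ha0 v
      split_ifs with hvQ
      · have h2 := hQ1 v hvQ
        constructor
        · have : 2 * ((s : ℤ) - k) * (s - r + q) ≤ 2 * k * s :=
            mul_le_mul (by linarith) (by linarith) (by linarith) (by linarith)
          have h3 : 0 ≤ (s : ℤ) * a v := mul_nonneg hs0'.le h1.1.le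
          linarith
        · linarith
      · have h2 := hQ2 v hv hvQ
        constructor
        · linarith
        · have h3 : (s : ℤ) * a v ≤ s * (2 * k) := mul_le_mul_of_nonneg_left h1.2 hs0'.le
          have h4 : 2 * ((s : ℤ) - k) * (r - q) ≤ 2 * (s - k) * s :=
            mul_le_mul_of_nonneg_left (by linarith) hu
          linarith

/-- Hall's condition for `T` together with `J = i + j` new vertices, all edges at new vertices being
present. At worst `j` is `max 0 (J - p)`. The left side is then convex in `J` and the right side
linear on `[0, p]` and on `[p, s]`, so only `J = 0`, `J = p` and `J = s` matter. The first is
trivial and the last follows from the total. -/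
theorem centre_numbers_bound {α : Type*} (X : Finset α) (ℓ γ : α → ℕ) {s k c p r : ℕ}
    (hs : (s : ℤ) * (2 * k - s) ≤ 2 * #X * (s - k)) (hpr : p + r = s) (hp : 0 < p)
    (htot : 2 * (k : ℤ) * (∑ v ∈ X, (γ v : ℤ) + c * s + r) =
      s * (s - 1) + 2 * #X * s + ∑ v ∈ X, (ℓ v : ℤ))
    (hγ : ∀ v ∈ X, 0 ≤ 2 * (k : ℤ) * γ v - ℓ v ∧ 2 * (k : ℤ) * γ v - ℓ v ≤ 2 * s)
    (h : r = 0 ∨ 2 * k ≤ s ∨ ∀ v ∈ X, 2 * ((s : ℤ) - k) * p ≤ s * (2 * (k : ℤ) * γ v - ℓ v) ∧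
      2 * ((s : ℤ) - k) * r ≤ s * (2 * s - (2 * (k : ℤ) * γ v - ℓ v)))
    {T : Finset α} (hT : T ⊆ X) {i j : ℕ} (hi : i ≤ p) (hj : j ≤ r) :
    ((i + j : ℕ) : ℤ) * ((i + j : ℕ) - 1) + 2 * (i + j : ℕ) * #T + ∑ v ∈ T, (ℓ v : ℤ) ≤
      2 * (k : ℤ) * (∑ v ∈ T, (γ v : ℤ) + c * i + (c + 1) * j) := by
  classical
  let a : α → ℤ := fun v => 2 * (k : ℤ) * γ v - ℓ v
  have hsum : ∀ T : Finset α, ∑ v ∈ T, a v = 2 * (k : ℤ) * ∑ v ∈ T, (γ v : ℤ) - ∑ v ∈ T, (ℓ v : ℤ) :=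
    fun T => by rw [sum_sub_distrib, mul_sum]
  have hX := hsum X
  have hTs := hsum T
  have hsplit : ∑ v ∈ X \ T, a v + ∑ v ∈ T, a v = ∑ v ∈ X, a v := sum_sdiff hT
  have hcard : (#(X \ T) : ℤ) + #T = #X := by exact_mod_cast card_sdiff_add_card_eq_card hT
  have hA0 : 0 ≤ ∑ v ∈ T, a v := sum_nonneg fun v hv => (hγ v (hT hv)).1
  have hB0 : ∑ v ∈ X \ T, a v ≤ #(X \ T) * (2 * s) := by
    rw [← nsmul_eq_mul]
    exact sum_le_card_nsmul _ _ _ fun v hv => (hγ v (mem_sdiff.1 hv).1).2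
  set A := ∑ v ∈ T, a v with hA
  set B := ∑ v ∈ X \ T, a v with hB
  set t : ℤ := (#T : ℤ) with ht
  set t' : ℤ := (#(X \ T) : ℤ) with ht'
  have ht0 : 0 ≤ t := Nat.cast_nonneg _
  have ht'0 : 0 ≤ t' := Nat.cast_nonneg _
  have hprZ : (p : ℤ) + r = s := by exact_mod_cast hpr
  have hpZ : (0 : ℤ) < p := by exact_mod_cast hp
  have hrZ : (0 : ℤ) ≤ r := Nat.cast_nonneg _
  have hkZ : (0 : ℤ) ≤ k := Nat.cast_nonneg _
  have hcZ : (0 : ℤ) ≤ c := Nat.cast_nonneg _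
  have hsZ : (0 : ℤ) < s := by linarith
  rw [← hcard] at htot
  have htot' : 2 * (k : ℤ) * (c * s + r) = s * (s - 1) + 2 * s * (t + t') - (A + B) := by
    linarith
  have hats : (s : ℤ) * (s - 1) + 2 * s * t - A ≤ 2 * k * (c * s + r) := by
    linarith
  -- The case `J = p` multiplied by `s`. In the third alternative the bounds on single vertices,
  -- summed over `T` and `X \ T`, leave `p * r` times the quadratic hypothesis `hs`.
  have hdef : 0 ≤ r * A + p * (2 * s * t' - B) - p * r * (2 * k - s) := by
    rcases h with h | h | h
    · subst h
      have : 0 ≤ (p : ℤ) * (2 * s * t' - B) := mul_nonneg hpZ.le (by linarith)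
      push_cast
      linarith
    · have h1 : (2 * (k : ℤ)) ≤ s := by exact_mod_cast h
      have h2 : 0 ≤ (p : ℤ) * (2 * s * t' - B) := mul_nonneg hpZ.le (by linarith)
      have h3 : 0 ≤ (r : ℤ) * A := mul_nonneg hrZ hA0
      have h4 : 0 ≤ (p : ℤ) * r * (s - 2 * k) := mul_nonneg (mul_nonneg hpZ.le hrZ) (by linarith)
      linarith
    · have h1 : t * (2 * ((s : ℤ) - k) * p) ≤ s * A := by
        rw [hA, mul_sum, ht, ← nsmul_eq_mul]
        exact card_nsmul_le_sum _ _ _ fun v hv => (h v (hT hv)).1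
      have h2 : t' * (2 * ((s : ℤ) - k) * r) ≤ s * (2 * s * t' - B) := by
        have : s * (2 * s * t' - B) = ∑ v ∈ X \ T, (s * (2 * s - a v)) := by
          rw [← mul_sum, sum_sub_distrib, sum_const, nsmul_eq_mul]
          ring
        rw [this, ht', ← nsmul_eq_mul]
        exact card_nsmul_le_sum _ _ _ fun v hv => (h v (mem_sdiff.1 hv).1).2
      refine le_of_mul_le_mul_left ?_ hsZ
      have h3 := mul_le_mul_of_nonneg_left h1 hrZ
      have h4 := mul_le_mul_of_nonneg_left h2 hpZ.le
      have h5 := mul_le_mul_of_nonneg_left hs (mul_nonneg hpZ.le hrZ)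
      rw [← hcard] at h5
      linarith
  have hatp : (p : ℤ) * (p - 1) + 2 * p * t - A ≤ 2 * k * (c * p) := by
    refine le_of_mul_le_mul_left ?_ hsZ
    have h1 : (p : ℤ) * s * (p + r) = p * s * s := by rw [hprZ]
    have h2 : ((p : ℤ) + r) * A = s * A := by rw [hprZ]
    have h3 := congrArg (fun y : ℤ => p * y) htot'
    linarith
  set J : ℤ := ((i + j : ℕ) : ℤ) with hJ
  have hJij : J = i + j := by rw [hJ]; push_cast; ring
  have hjZ : (0 : ℤ) ≤ j := Nat.cast_nonneg _
  have hiZ : (0 : ℤ) ≤ i := Nat.cast_nonneg _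
  have hiP : (i : ℤ) ≤ p := by exact_mod_cast hi
  have hjR : (j : ℤ) ≤ r := by exact_mod_cast hj
  have hkj : 0 ≤ (k : ℤ) * j := mul_nonneg hkZ hjZ
  suffices hgoal : J * (J - 1) + 2 * J * t - A ≤ 2 * k * (c * i + (c + 1) * j) by linarith
  rcases le_or_gt J p with hJp | hJp
  · have h1 : J * (J - 1) + 2 * J * t - A ≤ 2 * k * (c * J) := by
      refine le_of_mul_le_mul_left ?_ hpZ
      have h2 := mul_le_mul_of_nonneg_left hatp (by linarith : 0 ≤ J)
      have h3 : 0 ≤ (p - J) * A := mul_nonneg (by linarith) hA0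
      have h4 : 0 ≤ (p - J) * (p * J) := mul_nonneg (by linarith) (mul_nonneg hpZ.le (by linarith))
      linarith
    rw [hJij] at h1 ⊢
    linarith
  · have hr : (r : ℤ) = s - p := by linarith
    have hr0 : (0 : ℤ) < s - p := by linarith
    have h1 : J * (J - 1) + 2 * J * t - A ≤ 2 * k * (c * J + (J - p)) := by
      refine le_of_mul_le_mul_left ?_ hr0
      have h2 := mul_le_mul_of_nonneg_left hatp (by linarith : 0 ≤ s - J)
      have h3 := mul_le_mul_of_nonneg_left hats (by linarith : 0 ≤ J - p)
      have h4 : 0 ≤ (s - J) * (J - p) * (s - p) :=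
        mul_nonneg (mul_nonneg (by linarith) (by linarith)) hr0.le
      rw [hr] at h3
      linarith
    have h2 : 0 ≤ (k : ℤ) * (p - i) := mul_nonneg hkZ (by linarith)
    rw [hJij] at h1 ⊢
    linarith

/-- A graph in which the `s` vertices outside `X` are adjacent to all others has a `k`-star
decomposition if the obvious divisibility holds and `X` is large enough. -/
theorem exists_isStarDecomposition_of_universal {V : Type*} [Fintype V] [DecidableEq V]
    (G : SimpleGraph V) (X : Finset V) (hX : ∀ u ∉ X, ∀ v, v ≠ u → G.Adj u v) {s k : ℕ} (hk : 0 < k)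
    (hXs : #Xᶜ = s) (hks : k ≤ s) (hdiv : 2 * k ∣ ∑ v, adjCount G v univ)
    (hs : (s : ℤ) * (2 * k - s) ≤ 2 * #X * (s - k)) :
    ∃ B : Set (StarCopy V k), IsStarDecomposition G B := by
  let ℓ : V → ℕ := fun v => adjCount G v X
  have hcardV : #X + s = Fintype.card V := by rw [← hXs]; exact card_add_card_compl X
  have hdegX : ∀ v ∈ X, adjCount G v univ = ℓ v + s := by
    intro v hv
    rw [← adjCount_add_compl G v X, adjCount_of_forall_mem G (T := Xᶜ), hXs]
    intro w hw
    exact (hX w (mem_compl.1 hw) v fun h => mem_compl.1 hw (h ▸ hv)).symm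
  have hdegS : ∀ v ∈ Xᶜ, (adjCount G v univ : ℤ) = #X + s - 1 := by
    intro v hv
    have := adjCount_of_forall G (v := v) (T := univ) (fun w _ hw => hX v (mem_compl.1 hv) w hw)
      (mem_univ v)
    rw [card_univ, ← hcardV] at this
    zify at this
    linarith
  have hdeg : ((∑ v, adjCount G v univ : ℕ) : ℤ) =
      s * (s - 1) + 2 * #X * s + ∑ v ∈ X, (ℓ v : ℤ) := by
    rw [← sum_add_sum_compl X, sum_congr rfl hdegX]
    push_cast
    rw [sum_congr rfl hdegS, sum_add_distrib, sum_const, sum_const, hXs]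
    simp only [nsmul_eq_mul]
    ring
  have hdiv' : 2 * (k : ℤ) ∣ s * (s - 1) + 2 * #X * s + ∑ v ∈ X, (ℓ v : ℤ) := by
    rw [← hdeg]
    exact_mod_cast hdiv
  obtain ⟨γ, c, p, r, hpr, hp, htot, hγ, hcond⟩ := exists_centre_numbers X ℓ hk hks hdiv'
  obtain ⟨Y, hYX, hYr⟩ := exists_subset_card_eq (s := Xᶜ) (n := r) (by omega)
  let β : V → ℕ := fun v => if v ∈ X then γ v else if v ∈ Y then c + 1 else c
  have hβX : ∀ T ⊆ X, ∑ v ∈ T, β v = ∑ v ∈ T, γ v := fun T hT =>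
    sum_congr rfl fun v hv => if_pos (hT hv)
  have hβS : ∀ T ⊆ Xᶜ, ∑ v ∈ T, β v = c * #(T \ Y) + (c + 1) * #(T ∩ Y) := by
    intro T hT
    rw [← sum_inter_add_sum_sdiff T Y, add_comm]
    congr 1
    · rw [sum_congr rfl (g := fun _ => c), sum_const, smul_eq_mul, mul_comm]
      intro v hv
      rw [mem_sdiff] at hv
      simp [β, mem_compl.1 (hT hv.1), hv.2]
    · rw [sum_congr rfl (g := fun _ => c + 1), sum_const, smul_eq_mul, mul_comm]
      intro v hv
      rw [mem_inter] at hv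
      simp [β, mem_compl.1 (hT hv.1), hv.2]
  refine exists_isStarDecomposition G β ?_ ?_
  · have h1 : ∑ v, β v = ∑ v ∈ X, γ v + (c * #(Xᶜ \ Y) + (c + 1) * #(Xᶜ ∩ Y)) := by
      rw [← sum_add_sum_compl X, hβX X subset_rfl, hβS Xᶜ subset_rfl]
    have h2 : #(Xᶜ \ Y) = p := by
      rw [card_sdiff_of_subset hYX]; omega
    have h3 : #(Xᶜ ∩ Y) = r := by rw [inter_eq_right.2 hYX, hYr]
    zify at h1 ⊢
    push_cast at hdeg
    rw [hdeg, ← htot, h1, h2, h3, ← hpr]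
    push_cast
    ring
  · intro T
    have hT1 : T ∩ X ⊆ X := inter_subset_right
    have hT2 : T \ X ⊆ Xᶜ := fun v hv => mem_compl.2 (mem_sdiff.1 hv).2
    have hi : #((T \ X) \ Y) ≤ p := by
      have : #(Xᶜ \ Y) = p := by rw [card_sdiff_of_subset hYX]; omega
      rw [← this]
      exact card_le_card (sdiff_subset_sdiff hT2 subset_rfl)
    have hj : #((T \ X) ∩ Y) ≤ r := by
      rw [← hYr]
      exact card_le_card inter_subset_right
    have hb := centre_numbers_bound X ℓ γ hs hpr hp htot hγ hcond hT1 hi hj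
    rw [card_sdiff_add_card_inter] at hb
    have hTc : #(T ∩ X) + #(T \ X) = #T := card_inter_add_card_sdiff T X
    -- Degrees inside `T ∩ X` are replaced by the full degrees `ℓ v` inside `X`, so the structure of
    -- `G` on `X` plays no role.
    have e1 : ∑ v ∈ T ∩ X, adjCount G v T ≤ ∑ v ∈ T ∩ X, (ℓ v + #(T \ X)) := by
      refine sum_le_sum fun v _ => ?_
      have h1 := adjCount_le G v (T \ X)
      have h2 : adjCount G v T ≤ adjCount G v X + adjCount G v (T \ X) := by
        classical
        unfold adjCount
        refine (card_le_card ?_).trans (card_union_le _ _)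
        intro w
        simp only [mem_filter, mem_union, mem_sdiff]
        tauto
      exact h2.trans (Nat.add_le_add_left h1 _)
    have e2 : ∑ v ∈ T \ X, (adjCount G v T : ℤ) ≤ #(T \ X) * ((#T : ℤ) - 1) := by
      rw [← nsmul_eq_mul]
      refine sum_le_card_nsmul _ _ _ fun v hv => ?_
      have := adjCount_add_one_le G (mem_sdiff.1 hv).1
      zify at this
      linarith
    rw [← sum_inter_add_sum_sdiff T X, ← sum_inter_add_sum_sdiff T X β, hβX _ hT1, hβS _ hT2]
    rw [sum_add_distrib, sum_const, smul_eq_mul] at e1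
    zify at e1 hTc ⊢
    rw [← hTc] at e2
    linarith

/-! ### Packings with few stars and the order `3k + 1` -/

theorem leave_adj_of_notMem {V : Type*} {k : ℕ} {D : Finset (StarCopy V k)} {X : Finset V}
    (hX : ∀ S ∈ D, S.center ∈ X ∧ S.leaves ⊆ X) {u v : V} (hu : u ∉ X) (hv : v ≠ u) : (leave (D : Set (StarCopy V k))).Adj u v := by
  refine leave_adj.2 ⟨hv.symm, fun S hS h => hu ?_⟩
  rcases StarCopy.mem_edgeSet_iff.1 h with h | h
  · exact h.1 ▸ (hX S hS).1
  · exact (hX S hS).2 h.2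

section supported

variable {V : Type*} [Fintype V] [DecidableEq V] {k : ℕ} {D : Finset (StarCopy V k)} {X : Finset V}

/-- A vertex that is not a centre is in at most one edge of each star. -/
theorem card_le_adjCount_leave {v : V} (hv : v ∉ D.image StarCopy.center) :
    Fintype.card V ≤ adjCount (leave (D : Set (StarCopy V k))) v univ + 1 + #D := by
  classical
  have h1 : (univ : Finset V) ⊆
      ((univ.filter fun w => (leave (D : Set (StarCopy V k))).Adj v w) ∪ {v}) ∪ D.image StarCopy.center := by
    intro w _
    simp only [mem_union, mem_filter, mem_univ, true_and, mem_singleton, leave_adj]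
    by_contra! h
    obtain ⟨S, hS, hS'⟩ := h.1.1 (Ne.symm h.1.2)
    rcases StarCopy.mem_edgeSet_iff.1 hS' with h' | h'
    · exact hv (mem_image.2 ⟨S, hS, h'.1.symm⟩)
    · exact h.2 (mem_image.2 ⟨S, hS, h'.1.symm⟩)
  have h2 := card_le_card h1
  rw [card_univ] at h2
  refine h2.trans ((card_union_le _ _).trans (add_le_add ((card_union_le _ _).trans ?_)
    card_image_le))
  rw [card_singleton, adjCount]

/-- The number of stars in a packing of a small complete graph. -/
theorem card_add_le_of_card_le (hD : IsPartialStarDecomposition ⊤ (D : Set (StarCopy V k)))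
    (hX : ∀ S ∈ D, S.center ∈ X ∧ S.leaves ⊆ X) (hXk : #X ≤ 2 * k) :
    #D = 0 ∨ #D + 2 * k + 1 ≤ 2 * #X := by
  classical
  set G := leave (D : Set (StarCopy V k)) with hG
  -- Two stars with a common centre would occupy `2k + 1` vertices of `X`.
  have hinj : Set.InjOn StarCopy.center (D : Set (StarCopy V k)) := by
    intro S hS T hT hST
    by_contra hne
    have hdisj : Disjoint S.leaves T.leaves := by
      refine Finset.disjoint_left.2 fun w hw hw' => ?_
      exact Set.disjoint_left.1 (hD.2 S hS T hT hne)
        (StarCopy.mem_edgeSet_iff.2 (Or.inl ⟨rfl, hw⟩))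
        (StarCopy.mem_edgeSet_iff.2 (Or.inl ⟨hST, hw'⟩))
    have hsub : insert S.center (S.leaves ∪ T.leaves) ⊆ X :=
      insert_subset (hX S hS).1 (union_subset (hX S hS).2 (hX T hT).2)
    have h1 := card_le_card hsub
    rw [card_insert_of_notMem, card_union_of_disjoint hdisj, S.card_leaves, T.card_leaves] at h1
    · omega
    · rw [mem_union, not_or]
      exact ⟨S.center_notMem, hST ▸ T.center_notMem⟩
  set C := D.image StarCopy.center with hC
  have hCc : #C = #D := card_image_of_injOn hinj
  have hCX : C ⊆ X := by
    intro v hv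
    obtain ⟨S, hS, rfl⟩ := mem_image.1 hv
    exact (hX S hS).1
  have hZ : #(X \ C) + #D = #X := by rw [← hCc]; exact card_sdiff_add_card_eq_card hCX
  have hs : #X + #Xᶜ = Fintype.card V := card_add_card_compl X
  have hout : ∀ v ∈ X, adjCount G v Xᶜ = #Xᶜ := by
    intro v hv
    refine adjCount_of_forall_mem G fun w hw => ?_
    exact (leave_adj_of_notMem hX (mem_compl.1 hw) fun h => mem_compl.1 hw (h ▸ hv)).symm
  have hdeg : ∀ v ∈ X, adjCount G v univ = adjCount G v X + #Xᶜ := by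
    intro v hv
    rw [← adjCount_add_compl G v X, hout v hv]
  -- No star has an edge inside `X \ C`. So with `d = #D` centres, the `k * d` edges are among the
  -- `d(2 * #X - d - 1)/2` pairs meeting `C`, and dividing by `d` gives the bound.
  have h1 : ∀ v ∈ X \ C, (#(X \ C) : ℤ) - 1 + #Xᶜ ≤ adjCount G v univ := by
    intro v hv
    rw [hdeg v (mem_sdiff.1 hv).1]
    have h2 : adjCount G v (X \ C) + 1 = #(X \ C) := by
      refine adjCount_of_forall G (fun w hw hwv => leave_adj.2 ⟨hwv.symm, fun S hS h => ?_⟩) hv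
      rcases StarCopy.mem_edgeSet_iff.1 h with h | h
      · exact (mem_sdiff.1 hv).2 (mem_image.2 ⟨S, hS, h.1.symm⟩)
      · exact (mem_sdiff.1 hw).2 (mem_image.2 ⟨S, hS, h.1.symm⟩)
    have h3 := adjCount_mono G v (sdiff_subset : X \ C ⊆ X)
    zify at h2 h3 ⊢
    linarith
  have h2 : ∀ v ∈ C, (#Xᶜ : ℤ) ≤ adjCount G v univ := by
    intro v hv
    rw [hdeg v (hCX hv)]
    push_cast
    have : (0 : ℤ) ≤ adjCount G v X := Nat.cast_nonneg _
    linarith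
  have h3 : ∀ v ∈ Xᶜ, (Fintype.card V : ℤ) - 1 ≤ adjCount G v univ := by
    intro v hv
    have := adjCount_of_forall G (v := v) (T := univ)
      (fun w _ hw => leave_adj_of_notMem hX (mem_compl.1 hv) hw) (mem_univ v)
    rw [card_univ] at this
    zify at this
    linarith
  have e1 := card_nsmul_le_sum _ _ _ h1
  have e2 := card_nsmul_le_sum _ _ _ h2
  have e3 := card_nsmul_le_sum _ _ _ h3
  have e4 : ∑ v, (adjCount G v univ : ℤ) + 2 * (k * #D) =
      Fintype.card V * (Fintype.card V - 1) := by
    have := sum_adjCount_leave D hD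
    rcases Nat.eq_zero_or_pos (Fintype.card V) with h0 | h0
    · rw [h0] at this ⊢
      zify at this
      simpa using this
    · zify [h0] at this
      exact this
  rw [← sum_add_sum_compl X, ← sum_sdiff hCX] at e4
  simp only [nsmul_eq_mul] at e1 e2 e3
  rcases Nat.eq_zero_or_pos #D with h0 | h0
  · exact Or.inl h0
  · right
    rw [hCc] at e2
    zify at hZ hs h0 ⊢
    refine le_of_mul_le_mul_left ?_ h0
    have hz : (#(X \ C) : ℤ) = #X - #D := by linarith
    rw [← hs] at e3 e4
    rw [hz] at e1
    nlinarith

/-- `K_{3k+1}` takes `3(3k + 1)/2` stars, so the leave can have one star at every vertex and a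
second at `(3k + 1)/2 - #D` of them, the set `Y`. New vertices are used for `Y` first. If they run
out, then `D` is small and non-centres of `X`, whose degree in the leave is still large, fill the
gap. -/
theorem exists_isStarDecomposition_leave_of_three_mul
    (hD : IsPartialStarDecomposition ⊤ (D : Set (StarCopy V k)))
    (hX : ∀ S ∈ D, S.center ∈ X ∧ S.leaves ⊆ X) (hV : Fintype.card V = 3 * k + 1)
    (hs : k ≤ #Xᶜ) (hk : Odd k) (hd : 2 * #D ≤ 3 * k + 1) :
    ∃ B : Set (StarCopy V k), IsStarDecomposition (leave (D : Set (StarCopy V k))) B := by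
  set G := leave (D : Set (StarCopy V k)) with hG
  set C := D.image StarCopy.center with hC
  obtain ⟨m, hm⟩ := hk
  have hcard := card_add_card_compl X
  obtain ⟨Y, hYr, hY⟩ : ∃ Y : Finset V, 2 * #Y + 2 * #D = 3 * k + 1 ∧
      ∀ v ∈ Y, v ∈ X → v ∉ C ∧ 2 * #D ≤ k + 1 := by
    rcases le_or_gt (3 * m + 2 - #D) #Xᶜ with h | h
    · obtain ⟨Y, hYX, hYc⟩ := exists_subset_card_eq h
      exact ⟨Y, by omega, fun v hv hvX => absurd hvX (mem_compl.1 (hYX hv))⟩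
    · have h1 : #X - #D ≤ #(X \ C) :=
        (Nat.sub_le_sub_left card_image_le _).trans (le_card_sdiff C X)
      obtain ⟨Q, hQ, hQc⟩ := exists_subset_card_eq (s := X \ C) (n := 3 * m + 2 - #D - #Xᶜ)
        (by omega)
      refine ⟨Xᶜ ∪ Q, ?_, ?_⟩
      · rw [card_union_of_disjoint, hQc]
        · omega
        · exact disjoint_compl_left.mono_right (hQ.trans sdiff_subset)
      · intro v hv hvX
        rcases mem_union.1 hv with hv | hv
        · exact absurd hvX (mem_compl.1 hv)
        · exact ⟨(mem_sdiff.1 (hQ hv)).2, by omega⟩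
  have hγ : ∀ T : Finset V, ∑ v ∈ T, (1 + if v ∈ Y then 1 else 0) = #T + #(T ∩ Y) := by
    intro T
    rw [sum_add_distrib, sum_ite_mem]
    simp
  have htot : 2 * (k * ∑ v : V, (1 + if v ∈ Y then 1 else 0)) = ∑ v, adjCount G v univ := by
    have h1 := sum_adjCount_leave D hD
    rw [hV, Nat.add_sub_cancel] at h1
    rw [hγ, univ_inter, card_univ, hV]
    have h2 := congrArg (fun y => k * y) hYr
    linarith
  refine exists_isStarDecomposition G (fun v => 1 + if v ∈ Y then 1 else 0) htot fun T => ?_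
  rw [hγ T]
  have hT := card_add_card_compl T
  -- A small `T` is covered by one star per vertex, its inner degrees being at most `2k`. Otherwise
  -- the complement `R` has at most `k` vertices, and the edges meeting `R` are counted instead.
  rcases le_or_gt #T (2 * k + 1) with hTk | hTk
  · have h1 : ∀ v ∈ T, adjCount G v T ≤ 2 * k := fun v hv => by
      have := adjCount_add_one_le G hv
      omega
    have h2 := sum_le_card_nsmul _ _ _ h1
    rw [smul_eq_mul] at h2
    have h3 : 0 ≤ k * #(T ∩ Y) := Nat.zero_le _
    linarith
  · have h0 := sum_adjCount_add G Tᶜ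
    rw [compl_compl, ← htot, ← sum_add_sum_compl T, hγ, hγ] at h0
    set R := Tᶜ with hR
    have hRc : Rᶜ = T := by rw [hR, compl_compl]
    suffices hsuff : 2 * (k * (#R + #(R ∩ Y))) ≤ ∑ v ∈ R, (adjCount G v univ + adjCount G v T) by
      rw [mul_add k, mul_add 2] at h0
      omega
    have hparts1 := card_inter_add_card_sdiff R X
    have hparts2 := card_inter_add_card_sdiff (R ∩ X) Y
    have hRY : #(R ∩ Y) ≤ #((R ∩ X) ∩ Y) + #(R \ X) := by
      refine (card_le_card ?_).trans (card_union_le _ _)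
      intro v
      simp only [mem_inter, mem_union, mem_sdiff]
      tauto
    have hout : ∀ v ∈ X, ∀ w ∈ Xᶜ, G.Adj v w := fun v hv w hw =>
      (leave_adj_of_notMem hX (mem_compl.1 hw) fun h => mem_compl.1 hw (h ▸ hv)).symm
    have b1 : ∀ v ∈ R \ X, (2 * (3 * k + 1) - 1 - #R : ℤ) ≤
        ((adjCount G v univ + adjCount G v T : ℕ) : ℤ) := by
      intro v hv
      have h1 := adjCount_of_forall G (v := v) (T := univ)
        (fun w _ hw => leave_adj_of_notMem hX (mem_sdiff.1 hv).2 hw) (mem_univ v)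
      have h2 := adjCount_of_forall_mem G (v := v) (T := T) fun w hw =>
        leave_adj_of_notMem hX (mem_sdiff.1 hv).2 fun h =>
          mem_compl.1 (mem_sdiff.1 hv).1 (h ▸ hw)
      rw [card_univ, hV] at h1
      omega
    have b2 : ∀ v ∈ (R ∩ X) \ Y, (2 * #Xᶜ - #(R \ X) : ℤ) ≤
        ((adjCount G v univ + adjCount G v T : ℕ) : ℤ) := by
      intro v hv
      have hvX := (mem_inter.1 (mem_sdiff.1 hv).1).2
      have h1 := adjCount_mono G v (subset_univ Xᶜ)
      have h2 := adjCount_mono G v (S := Xᶜ \ R) (T := T) fun w hw => by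
        have := (mem_sdiff.1 hw).2
        rw [hR, mem_compl, not_not] at this
        exact this
      rw [adjCount_of_forall_mem G (hout v hvX)] at h1
      rw [adjCount_of_forall_mem G fun w hw => hout v hvX w (mem_sdiff.1 hw).1] at h2
      have h3 : #(Xᶜ \ R) + #(R \ X) = #Xᶜ := by
        rw [← card_sdiff_add_card_inter Xᶜ R]
        congr 2
        ext w
        simp [and_comm]
      omega
    have b3 : ∀ v ∈ (R ∩ X) ∩ Y, (2 * (3 * k + 1) - 1 - 2 * #D - #R : ℤ) ≤
        ((adjCount G v univ + adjCount G v T : ℕ) : ℤ) := by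
      intro v hv
      rw [mem_inter, mem_inter] at hv
      have h1 := card_le_adjCount_leave (hY v hv.2 hv.1.2).1
      have h2 := adjCount_add_compl G v R
      have h3 := adjCount_add_one_le G hv.1.1
      rw [hRc] at h2
      rw [hV, ← hG] at h1
      omega
    have e1 := card_nsmul_le_sum _ _ _ b1
    have e2 := card_nsmul_le_sum _ _ _ b2
    have e3 := card_nsmul_le_sum _ _ _ b3
    have hRk : (#R : ℤ) ≤ k := by omega
    have hq : 0 ≤ (#((R ∩ X) ∩ Y) : ℤ) * (k + 1 - 2 * #D + (k - #R)) := by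
      rcases ((R ∩ X) ∩ Y).eq_empty_or_nonempty with h | ⟨v, hv⟩
      · simp [h]
      · rw [mem_inter, mem_inter] at hv
        have := (hY v hv.2 hv.1.2).2
        exact mul_nonneg (Nat.cast_nonneg _) (by omega)
    rw [← sum_inter_add_sum_sdiff R X, ← sum_inter_add_sum_sdiff (R ∩ X) Y]
    simp only [nsmul_eq_mul] at e1 e2 e3
    -- The loss of `#(R \ X)` at each vertex of `(R ∩ X) \ Y` is paid by the new vertices in `R`,
    -- which need at most `4k` and have `6k + 1 - #R`.
    have g1 : (0 : ℤ) ≤ #(R \ X) * (k + 1 + (k - #R) - #((R ∩ X) \ Y)) :=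
      mul_nonneg (Nat.cast_nonneg _) (by omega)
    have g2 : (0 : ℤ) ≤ #((R ∩ X) \ Y) * (2 * (#Xᶜ - k)) :=
      mul_nonneg (Nat.cast_nonneg _) (by omega)
    have g3 : (k : ℤ) * #(R ∩ Y) ≤ k * (#((R ∩ X) ∩ Y) + #(R \ X)) :=
      mul_le_mul_of_nonneg_left (by exact_mod_cast hRY) (Nat.cast_nonneg _)
    have g4 : (k : ℤ) * #R = k * (#((R ∩ X) ∩ Y) + #((R ∩ X) \ Y) + #(R \ X)) := by
      congr 1; omega
    zify
    push_cast at e1 e2 e3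
    linarith

end supported

/-! ### The upper bound -/

/-- The image of a packing in `K_{n+s}`, with the vertex set of `K_n`. -/
theorem exists_image_castAddEmb {n k : ℕ} (s : ℕ) {D : Finset (StarCopy (Fin n) k)}
    (hD : IsPartialStarDecomposition ⊤ (D : Set (StarCopy (Fin n) k))) :
    ∃ (D' : Finset (StarCopy (Fin (n + s)) k)) (X : Finset (Fin (n + s))),
      StarCopy.map (Fin.castAddEmb s) '' (D : Set (StarCopy (Fin n) k)) = D' ∧
      IsPartialStarDecomposition ⊤ (D' : Set (StarCopy (Fin (n + s)) k)) ∧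
      (∀ S ∈ D', S.center ∈ X ∧ S.leaves ⊆ X) ∧ #X = n ∧ #Xᶜ = s ∧ #D' = #D := by
  classical
  have hco : StarCopy.map (Fin.castAddEmb s) '' (D : Set (StarCopy (Fin n) k)) =
      (D.image (StarCopy.map (Fin.castAddEmb s)) : Finset _) := by rw [coe_image]
  refine ⟨D.image (StarCopy.map (Fin.castAddEmb s)), univ.map (Fin.castAddEmb s), hco, ?_, ?_, ?_,
    ?_, card_image_of_injective _ (StarCopy.map_injective _)⟩
  · rw [← hco]
    exact hD.map _
  · intro S hS
    obtain ⟨S, -, rfl⟩ := mem_image.1 hS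
    exact ⟨mem_map_of_mem _ (mem_univ _), map_subset_map.2 (subset_univ _)⟩
  · simp
  · rw [card_compl]
    simp

/-- A star has `k + 1` vertices, so `D` is empty, and one star at each vertex meets Hall's condition
because all degrees are `2k`. -/
theorem embedsInDecomposition_of_two_mul {n k s : ℕ} (hN : n + s = 2 * k + 1) (hn : n ≤ k)
    (D : Set (StarCopy (Fin n) k)) : EmbedsInDecomposition D s := by
  have hempty : D = ∅ := by
    refine Set.eq_empty_of_forall_notMem fun S _ => ?_
    have h1 := card_le_univ (insert S.center S.leaves)
    rw [card_insert_of_notMem S.center_notMem, S.card_leaves, Fintype.card_fin] at h1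
    omega
  subst hempty
  have hpart : IsPartialStarDecomposition ⊤ (∅ : Set (StarCopy (Fin n) k)) :=
    ⟨fun _ h => h.elim, fun _ h => h.elim⟩
  refine embedsInDecomposition_of_leave hpart ?_
  have hpart' : IsPartialStarDecomposition ⊤
      ((∅ : Finset (StarCopy (Fin (n + s)) k)) : Set (StarCopy (Fin (n + s)) k)) := by
    rw [coe_empty]
    exact ⟨fun _ h => h.elim, fun _ h => h.elim⟩
  have h1 := sum_adjCount_leave _ hpart'
  rw [Set.image_empty]
  rw [coe_empty, card_empty, Fintype.card_fin] at h1
  refine exists_isStarDecomposition _ (fun _ => 1) ?_ fun T => ?_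
  · rw [mul_zero, mul_zero, add_zero] at h1
    simp only [sum_const, card_univ, Fintype.card_fin, smul_eq_mul, mul_one]
    rw [h1, show n + s - 1 = 2 * k by omega]
    ring
  · have h2 : ∀ v ∈ T, adjCount (leave (∅ : Set (StarCopy (Fin (n + s)) k))) v T ≤ 2 * k := by
      intro v hv
      have h3 := adjCount_add_one_le (leave (∅ : Set (StarCopy (Fin (n + s)) k))) hv
      have h4 := card_le_univ T
      rw [Fintype.card_fin] at h4
      omega
    have h3 := sum_le_card_nsmul _ _ _ h2
    simp only [sum_const, smul_eq_mul] at h3 ⊢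
    linarith

/-- Here `5k ≤ 4s` gives `n ≤ 7k/4 + 1`, so `#D ≤ 2n - 2k - 1 ≤ 3k/2 + 1`; as `k` is odd, `2 * #D ≤
3k + 1`. -/
theorem embedsInDecomposition_of_three_mul {n k s : ℕ} (hN : n + s = 3 * k + 1) (hk : Odd k)
    (hk2 : 2 ≤ k) (hs : 5 * k ≤ 4 * s) {D : Finset (StarCopy (Fin n) k)}
    (hD : IsPartialStarDecomposition ⊤ (D : Set (StarCopy (Fin n) k))) :
    EmbedsInDecomposition (D : Set (StarCopy (Fin n) k)) s := by
  refine embedsInDecomposition_of_leave hD ?_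
  obtain ⟨D', X, hco, hD', hX, hXn, hXs, hDc⟩ := exists_image_castAddEmb s hD
  rw [hco]
  obtain ⟨m, hm⟩ := hk
  refine exists_isStarDecomposition_leave_of_three_mul hD' hX (by simpa using hN) (by omega)
    ⟨m, hm⟩ ?_
  have := card_add_le_of_card_le hD' hX (by omega)
  omega

theorem embedsInDecomposition_of_large {n k s : ℕ} (hk : 0 < k)
    (hdiv : 2 * k ∣ (n + s) * (n + s - 1)) (hks : k ≤ s)
    (hs : (s : ℤ) * (2 * k - s) ≤ 2 * n * (s - k)) {D : Finset (StarCopy (Fin n) k)}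
    (hD : IsPartialStarDecomposition ⊤ (D : Set (StarCopy (Fin n) k))) :
    EmbedsInDecomposition (D : Set (StarCopy (Fin n) k)) s := by
  refine embedsInDecomposition_of_leave hD ?_
  obtain ⟨D', X, hco, hD', hX, hXn, hXs, hDc⟩ := exists_image_castAddEmb s hD
  rw [hco]
  refine exists_isStarDecomposition_of_universal _ X
    (fun u hu v hv => leave_adj_of_notMem hX hu hv) hk hXs hks ?_ (by rw [hXn]; exact hs)
  have h1 := sum_adjCount_leave D' hD'
  rw [Fintype.card_fin] at h1
  rw [← h1] at hdiv
  exact (Nat.dvd_add_left ⟨#D', by ring⟩).1 hdiv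

theorem exists_nat_mem_Ico_modEq (n m : ℕ) (hm : 0 < m) (y : ℝ) (hy : 0 ≤ y) (hn : 1 ≤ n) :
    ∃ s j : ℕ, y ≤ s ∧ (s : ℝ) < y + m ∧ n + s = j * m + 1 := by
  have hm' : (0 : ℝ) < m := by exact_mod_cast hm
  have hn' : (1 : ℝ) ≤ n := by exact_mod_cast hn
  obtain ⟨j, hj1, hj2⟩ : ∃ j : ℕ, (y + n - 1) / m ≤ j ∧ (j : ℝ) < (y + n - 1) / m + 1 :=
    ⟨_, Nat.le_ceil _, Nat.ceil_lt_add_one (div_nonneg (by linarith) hm'.le)⟩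
  rw [div_le_iff₀ hm'] at hj1
  have hj2' : (j - 1 : ℝ) * m < y + n - 1 := by
    rw [← lt_div_iff₀ hm']; linarith
  have hnj : n ≤ j * m + 1 := by
    have : (n : ℝ) ≤ (j * m + 1 : ℕ) := by push_cast; linarith
    exact_mod_cast this
  refine ⟨j * m + 1 - n, j, ?_, ?_, by omega⟩
  · push_cast [hnj]; linarith
  · push_cast [hnj]; linarith

theorem exists_embedsInDecomposition_of_odd {k n : ℕ} (hk : 2 ≤ k) (hn : 1 ≤ n) (hodd : Odd k)
    {D : Finset (StarCopy (Fin n) k)}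
    (hD : IsPartialStarDecomposition ⊤ (D : Set (StarCopy (Fin n) k))) :
    ∃ s : ℕ, (s : ℝ) < 9 / 4 * k ∧ EmbedsInDecomposition (D : Set (StarCopy (Fin n) k)) s := by
  obtain ⟨s, j, h1, h2, hN⟩ := exists_nat_mem_Ico_modEq n k (by omega) (5 / 4 * k) (by positivity) hn
  have h1' : 5 * k ≤ 4 * s := by
    have : (5 * k : ℝ) ≤ 4 * s := by linarith
    exact_mod_cast this
  refine ⟨s, by linarith, ?_⟩
  have h2' : 4 * s < 9 * k := by
    have : (4 * s : ℝ) < 9 * k := by linarith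
    exact_mod_cast this
  rcases lt_or_ge j 4 with hj | hj
  · interval_cases j
    · omega
    · omega
    · exact embedsInDecomposition_of_two_mul hN (by omega) _
    · exact embedsInDecomposition_of_three_mul hN hodd hk h1' hD
  · refine embedsInDecomposition_of_large (by omega) ?_ (by omega) ?_ hD
    -- For odd `k`, working modulo `k` suffices: the missing factor 2 comes from `j` or `j * k + 1`.
    · have heven : Even (j * (j * k + 1)) := by
        rw [Nat.even_mul, Nat.even_add_one, Nat.even_mul]
        have : ¬ Even k := Nat.not_even_iff_odd.2 hodd
        tauto
      obtain ⟨e, he⟩ := heven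
      refine ⟨e, ?_⟩
      rw [hN, Nat.add_sub_cancel]
      calc (j * k + 1) * (j * k) = k * (j * (j * k + 1)) := by ring
        _ = 2 * k * e := by rw [he]; ring
    · have hk4 : 4 * k ≤ j * k := Nat.mul_le_mul_right k hj
      have h3 : (4 * k + 1 : ℤ) ≤ n + s := by exact_mod_cast (by omega : 4 * k + 1 ≤ n + s)
      zify at h1' h2' hk
      have h4 : 0 ≤ (4 * (s : ℤ) - 5 * k) * (9 * k - 4 * s) :=
        mul_nonneg (by linarith) (by linarith)
      have h5 : 0 ≤ (n + s - (4 * k + 1) : ℤ) * (s - k) := mul_nonneg (by linarith) (by linarith)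
      have h6 : 0 ≤ (4 * (s : ℤ) - 5 * k) * k := mul_nonneg (by linarith) (by linarith)
      nlinarith

theorem exists_embedsInDecomposition_of_even {k n : ℕ} (hk : 2 ≤ k) (hn : 1 ≤ n)
    {D : Finset (StarCopy (Fin n) k)}
    (hD : IsPartialStarDecomposition ⊤ (D : Set (StarCopy (Fin n) k))) :
    ∃ s : ℕ, (s : ℝ) < (6 - 2 * Real.sqrt 2) * k ∧
      EmbedsInDecomposition (D : Set (StarCopy (Fin n) k)) s := by
  have hsq : Real.sqrt 2 * Real.sqrt 2 = 2 := Real.mul_self_sqrt (by norm_num)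
  have hlt : Real.sqrt 2 < 3 / 2 := by
    rw [Real.sqrt_lt' (by norm_num)]; norm_num
  have hgt : 1 < Real.sqrt 2 := by
    rw [Real.lt_sqrt (by norm_num)]; norm_num
  have hk0 : (0 : ℝ) < k := by exact_mod_cast (by omega : 0 < k)
  obtain ⟨s, j, h1, h2, hN⟩ := exists_nat_mem_Ico_modEq n (2 * k) (by omega)
    ((4 - 2 * Real.sqrt 2) * k) (mul_nonneg (by linarith) hk0.le) hn
  push_cast at h2
  refine ⟨s, by linarith, ?_⟩
  have hks : k < s := by
    have : (k : ℝ) < s := by nlinarith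
    exact_mod_cast this
  rcases lt_or_ge j 2 with hj | hj
  · interval_cases j
    · omega
    · exact embedsInDecomposition_of_two_mul (by omega) (by omega) _
  · refine embedsInDecomposition_of_large (by omega) ?_ hks.le ?_ hD
    · rw [hN, Nat.add_sub_cancel]
      exact ⟨(j * (2 * k) + 1) * j, by ring⟩
    · have hk4 : 2 * (2 * k) ≤ j * (2 * k) := Nat.mul_le_mul_right _ hj
      have h3 : (4 * k + 1 : ℝ) ≤ n + s := by exact_mod_cast (by omega : 4 * k + 1 ≤ n + s)
      have hks' : (k : ℝ) < s := by exact_mod_cast hks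
      -- The roots of `s² - 8ks + 8k²` are `(4 ± 2√2)k`, and the window for `s` lies between them.
      have h4 : 0 ≤ (s - (4 - 2 * Real.sqrt 2) * k) * ((4 + 2 * Real.sqrt 2) * k - s) :=
        mul_nonneg (by linarith) (by nlinarith)
      have h5 : 0 ≤ (n + s - (4 * k + 1) : ℝ) * (s - k) := mul_nonneg (by linarith) (by linarith)
      have h6 : (Real.sqrt 2 * Real.sqrt 2) * ((k : ℝ) * k) = 2 * (k * k) := by rw [hsq]
      have h7 : (s : ℝ) * (2 * k - s) ≤ 2 * n * (s - k) := by linarith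
      exact_mod_cast h7

/-! ### Sharpness of both constants -/

/-- Packings of `K_n` with many stars in which no large set is pairwise joined by edges of the
stars: no star has an edge inside any of the blocks of `w` consecutive vertices. -/
theorem exists_packing_avoiding_blocks {n k w g b : ℕ} (hk : 0 < k) (hw : 0 < w) (hb : b ≤ n)
    (h1 : 2 * k * (g + 1) + 2 * w + b ≤ 2 * n + 1)
    (h2 : 2 * k * (g * n + b) + n * (2 * w + n) ≤ n * (2 * n + 1)) :
    ∃ D : Finset (StarCopy (Fin n) k),
      IsPartialStarDecomposition ⊤ (D : Set (StarCopy (Fin n) k)) ∧ #D = g * n + b ∧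
      ∀ T : Finset (Fin n), (∀ u ∈ T, ∀ v ∈ T, u ≠ v →
        ¬ (leave (D : Set (StarCopy (Fin n) k))).Adj u v) → #T ≤ n / w + 1 := by
  classical
  let H : SimpleGraph (Fin n) :=
    { Adj := fun i j => (i : ℕ) / w ≠ j / w
      symm := ⟨fun _ _ h => h.symm⟩
      loopless := ⟨fun _ h => h rfl⟩ }
  obtain ⟨Y, -, hY⟩ := exists_subset_card_eq (s := (univ : Finset (Fin n))) (n := b) (by simpa)
  have hγ : ∀ T : Finset (Fin n), ∑ v ∈ T, (g + if v ∈ Y then 1 else 0) = g * #T + #(T ∩ Y) := by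
    intro T
    rw [sum_add_distrib, sum_ite_mem]
    simp [mul_comm]
  have hdeg : ∀ v, n ≤ adjCount H v univ + w := by
    intro v
    have e1 := card_filter_add_card_filter_not (s := (univ : Finset (Fin n))) (fun u => H.Adj v u)
    rw [card_univ, Fintype.card_fin] at e1
    have e2 : #{u ∈ (univ : Finset (Fin n)) | ¬ H.Adj v u} ≤ w := by
      have : #({u ∈ (univ : Finset (Fin n)) | ¬ H.Adj v u}.map Fin.valEmbedding) ≤
          #(Finset.Ico (v / w * w) (v / w * w + w)) := by
        refine card_le_card fun x hx => ?_
        obtain ⟨u, hu, rfl⟩ := mem_map.1 hx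
        have hu' : (v : ℕ) / w = u / w := by simpa [H] using hu
        rw [mem_Ico, hu', Fin.valEmbedding_apply]
        exact ⟨Nat.div_mul_le_self _ _, Nat.lt_div_mul_add hw⟩
      rwa [card_map, Nat.card_Ico, Nat.add_sub_cancel_left] at this
    have e3 : adjCount H v univ = #{u ∈ (univ : Finset (Fin n)) | H.Adj v u} := by
      unfold adjCount
      congr
    omega
  have hcond : ∀ T : Finset (Fin n), 2 * (k * ∑ v ∈ T, (g + if v ∈ Y then 1 else 0)) ≤
      ∑ v ∈ T, (adjCount H v univ + adjCount H v Tᶜ) := by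
    intro T
    rw [hγ]
    have e1 : ∀ v ∈ T, (2 * n - 2 * w - #T + 1 : ℤ) ≤
        ((adjCount H v univ + adjCount H v Tᶜ : ℕ) : ℤ) := by
      intro v hv
      have f1 := adjCount_add_compl H v T
      have f2 := adjCount_add_one_le H hv
      have f3 := hdeg v
      omega
    have e2 := card_nsmul_le_sum _ _ _ e1
    rw [nsmul_eq_mul] at e2
    have htY : #(T ∩ Y) ≤ b := hY ▸ card_le_card inter_subset_right
    have htT : #(T ∩ Y) ≤ #T := card_le_card inter_subset_left
    have htn : #T ≤ n := by simpa using card_le_univ T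
    zify at h1 h2 hb htY htT htn hk ⊢
    push_cast at e2
    refine le_trans ?_ e2
    have ht0 : (0 : ℤ) ≤ #T := Nat.cast_nonneg _
    have hb0 : (0 : ℤ) ≤ b := Nat.cast_nonneg _
    -- For `#T ≤ b` the hypothesis `h1` suffices. Beyond `b` the demand is linear and the supply
    -- concave in `#T`, so the claim interpolates between `#T = b` (`h1`) and `#T = n` (`h2`).
    rcases le_or_gt (#T : ℤ) b with htb | htb
    · have f1 := mul_le_mul_of_nonneg_left htT hk.le
      have f2 := mul_le_mul_of_nonneg_left h1 ht0
      have f3 := mul_le_mul_of_nonneg_left htb ht0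
      linarith
    · have f1 := mul_le_mul_of_nonneg_left htY hk.le
      have f2 := mul_le_mul_of_nonneg_left h1 hb0
      have hnb : (0 : ℤ) < n - b := by linarith
      suffices hs : (2 * (k * (g * #T + b)) : ℤ) ≤ #T * (2 * n - 2 * w - #T + 1) by linarith
      refine le_of_mul_le_mul_left ?_ hnb
      have f3 := mul_le_mul_of_nonneg_left f2 (by linarith : (0 : ℤ) ≤ n - #T)
      have f4 := mul_le_mul_of_nonneg_left h2 (by linarith : (0 : ℤ) ≤ #T - b)
      have f5 : (0 : ℤ) ≤ (#T - b) * (n - #T) * (n - b) :=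
        mul_nonneg (mul_nonneg (by linarith) (by linarith)) hnb.le
      linarith
  obtain ⟨st, -, hst, hdisj, -⟩ := exists_star_packing (k := k) H _ hcond
  have hinj : Function.Injective st := by
    intro x y hxy
    by_contra hne
    have e1 := hdisj x y hne
    rw [hxy, disjoint_self] at e1
    exact (StarCopy.edgeSet_nonempty hk (st y)).ne_empty e1
  refine ⟨univ.image st, ⟨fun S _ => S.edgeSet_subset_top, ?_⟩, ?_, ?_⟩
  · intro S hS T hT hne
    obtain ⟨x, -, rfl⟩ := mem_image.1 (mem_coe.1 hS)
    obtain ⟨y, -, rfl⟩ := mem_image.1 (mem_coe.1 hT)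
    exact hdisj x y fun h => hne (by rw [h])
  · rw [card_image_of_injective _ hinj, card_univ, Fintype.card_sigma]
    simp only [Fintype.card_fin]
    rw [hγ, univ_inter, hY, card_univ, Fintype.card_fin]
  · intro T hT
    -- Vertices of one block are adjacent in the leave, so `T` has at most one vertex in each block.
    have hinjT : Set.InjOn (fun i : Fin n => (i : ℕ) / w) (T : Set (Fin n)) := by
      intro u hu v hv huv
      by_contra hne
      have e1 := hT u hu v hv hne
      rw [leave_adj] at e1
      push Not at e1
      obtain ⟨S, hS, hS'⟩ := e1 hne
      obtain ⟨x, -, rfl⟩ := mem_image.1 (mem_coe.1 hS)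
      exact hst x hS' huv
    rw [← card_image_of_injOn hinjT]
    have : T.image (fun i : Fin n => (i : ℕ) / w) ⊆ range (n / w + 1) := by
      intro x hx
      obtain ⟨i, -, rfl⟩ := mem_image.1 hx
      rw [mem_range, Nat.lt_succ_iff]
      exact Nat.div_le_div_right i.2.le
    simpa using card_le_card this

/-- `N` and `N - 1` are coprime, so `q` divides one of them and `N` is 0 or 1 modulo `q`. -/
theorem le_of_isPrimePow_dvd {q N j : ℕ} (hq : IsPrimePow q) (hN : 1 ≤ N) (hdvd : q ∣ N * (N - 1))
    (hlt : N < (j + 1) * q) : N ≤ j * q + 1 := by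
  have hcop : Nat.Coprime N (N - 1) := by
    obtain ⟨m, rfl⟩ : ∃ m, N = m + 1 := ⟨N - 1, by omega⟩
    rw [Nat.add_sub_cancel]
    exact (Nat.coprime_self_add_left).2 (Nat.coprime_one_left _)
  rcases (hcop.isPrimePow_dvd_mul hq).1 hdvd with ⟨a, ha⟩ | ⟨a, ha⟩
  · have h1 : a < j + 1 := by
      rw [ha, mul_comm] at hlt
      exact lt_of_mul_lt_mul_right hlt (Nat.zero_le _)
    have h2 : a * q ≤ j * q := Nat.mul_le_mul_right _ (by omega)
    rw [mul_comm] at h2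
    omega
  · have h1 : a < j + 1 := by
      have : q * a < (j + 1) * q := by omega
      rw [mul_comm] at this
      exact lt_of_mul_lt_mul_right this (Nat.zero_le _)
    have h2 : a * q ≤ j * q := Nat.mul_le_mul_right _ (by omega)
    rw [mul_comm] at h2
    omega

/-- An upper bound for the number of stars in a decomposition of `K_N` in excess of `N`. -/
theorem two_mul_le_of_card_eq {k N M j : ℕ} (hk : 0 < k) (hM : 2 * (k * M) = N * (N - 1))
    (hN : 1 ≤ N) (hj : 2 ≤ j) (hle : N ≤ j * k + 1) : 2 * M ≤ 2 * N + (j - 2) * (j * k + 1) := by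
  obtain ⟨i, rfl⟩ : ∃ i, j = i + 2 := ⟨j - 2, by omega⟩
  obtain ⟨m, rfl⟩ : ∃ m, N = m + 1 := ⟨N - 1, by omega⟩
  simp only [Nat.add_sub_cancel] at hM ⊢
  have h1 : m ≤ (i + 2) * k := by omega
  refine le_of_mul_le_mul_left ?_ hk
  have h2 := Nat.mul_le_mul_left (m + 1) h1
  have h3 := Nat.mul_le_mul_left (i * k) hle
  have h4 : k * (2 * M) = (m + 1) * m := by rw [← hM]; ring
  rw [h4]
  calc (m + 1) * m ≤ (m + 1) * ((i + 2) * k) := h2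
    _ = i * k * (m + 1) + k * (2 * (m + 1)) := by ring
    _ ≤ i * k * ((i + 2) * k + 1) + k * (2 * (m + 1)) := by gcongr
    _ = k * (2 * (m + 1) + i * ((i + 2) * k + 1)) := by ring

/-- With `n` near `(7/4 + ε)k`, every `s < ck` has `n + s < 4k`, hence `n + s ≤ 3k + 1` and the
total exceeds `n + s` by at most `(3k + 1)/2`. The `b` stars of `D`, with distinct centres, number
more than that by about `εk/2`, while the blocks cost only `n / w ≤ εk/8`. -/
theorem exists_not_embedsInDecomposition_of_prime {c ε : ℝ} (hε : 0 < ε) (hε' : ε ≤ 1 / 4)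
    (hc : c ≤ 9 / 4 - ε) {w k : ℕ} (hw : 16 / ε ≤ w) (hk : k.Prime) (hkw : (4 * w + 200) / ε ≤ k) :
    ∃ n : ℕ, 1 ≤ n ∧ ∃ D : Set (StarCopy (Fin n) k), IsPartialStarDecomposition ⊤ D ∧
      ∀ s : ℕ, (s : ℝ) < c * k → ¬ EmbedsInDecomposition D s := by
  rw [div_le_iff₀ hε] at hkw hw
  have hw0 : (0 : ℝ) < w := by
    by_contra! h
    nlinarith
  have hk0 : (0 : ℝ) < k := by exact_mod_cast hk.pos
  have hεk : ε * k ≤ 1 / 4 * k := mul_le_mul_of_nonneg_right hε' hk0.le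
  obtain ⟨n, hn1, hn2⟩ : ∃ n : ℕ, (n : ℝ) ≤ (7 / 4 + ε) * k ∧ (7 / 4 + ε) * k < n + 1 :=
    ⟨_, Nat.floor_le (by positivity), Nat.lt_floor_add_one _⟩
  obtain ⟨b, hb1, hb2⟩ : ∃ b : ℕ, (3 / 2 + ε / 2) * k ≤ b ∧ (b : ℝ) < (3 / 2 + ε / 2) * k + 1 :=
    ⟨_, Nat.le_ceil _, Nat.ceil_lt_add_one (by positivity)⟩
  have hn0 : (1 : ℝ) ≤ n := by linarith
  have hbn : (b : ℝ) ≤ n := by linarith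
  have h1 : (2 * k * (0 + 1) + 2 * w + b : ℝ) ≤ 2 * n + 1 := by linarith
  have hn3 : (7 / 4 + ε / 2) * k ≤ n - 2 * w := by linarith
  have hn4 : 7 / 4 * (k : ℝ) ≤ n := by linarith
  have h2 : (2 * k * (0 * n + b) + n * (2 * w + n) : ℝ) ≤ n * (2 * n + 1) := by
    have e1 : 7 / 4 * (k : ℝ) * ((7 / 4 + ε / 2) * k) ≤ n * (n - 2 * w) :=
      mul_le_mul hn4 hn3 (by positivity) (by positivity)
    have e2 : (k : ℝ) * b ≤ k * ((3 / 2 + ε / 2) * k + 1) :=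
      mul_le_mul_of_nonneg_left hb2.le hk0.le
    have e3 : ε * k * k ≤ 1 / 4 * k * k := mul_le_mul_of_nonneg_right hεk hk0.le
    have e4 : (200 : ℝ) * k ≤ 1 / 4 * k * k := mul_le_mul_of_nonneg_right (by linarith) hk0.le
    linarith
  obtain ⟨D, hD, hDc, hA⟩ := exists_packing_avoiding_blocks (g := 0) hk.pos
    (by exact_mod_cast hw0) (by exact_mod_cast hbn) (by exact_mod_cast h1) (by exact_mod_cast h2)
  have hn1' : 1 ≤ n := by exact_mod_cast hn0
  refine ⟨n, hn1', D, hD, fun s hs hemb => ?_⟩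
  obtain ⟨M, hM, hMle⟩ := hemb.exists_card hA
  have hlt : n + s < (3 + 1) * k := by
    have : (n + s : ℝ) < (3 + 1) * k := by
      have := mul_le_mul_of_nonneg_right hc hk0.le
      linarith
    exact_mod_cast this
  have hle := le_of_isPrimePow_dvd hk.isPrimePow (by omega) ⟨2 * M, by rw [← hM]; ring⟩ hlt
  have h3 := two_mul_le_of_card_eq hk.pos hM (by omega) (by norm_num) hle
  have h4 : ((n / w : ℕ) : ℝ) ≤ n * (ε / 16) := by
    refine Nat.cast_div_le.trans ?_
    rw [div_le_iff₀ hw0]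
    nlinarith
  have h5 : (n : ℝ) * (ε / 16) ≤ 2 * k * (ε / 16) :=
    mul_le_mul_of_nonneg_right (by linarith) (by positivity)
  have h6 : (2 * M : ℝ) ≤ 2 * (n + s) + (3 * k + 1) := by
    have : 2 * M ≤ 2 * (n + s) + (3 * k + 1) := by omega
    exact_mod_cast this
  have h7 : (n + s + b : ℝ) ≤ M + ((n / w : ℕ) : ℝ) + 2 := by
    have : n + s + b ≤ M + n / w + 2 := by omega
    exact_mod_cast this
  linarith

/-- Now `2k` is itself a prime power dividing `N(N - 1)`, where `N = n + s < 6k`, so `N ≤ 4k + 1`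
and the excess is at most `4k + 1`. The packing has `d ≥ (4 + ε)k` stars; since `K_n` has about
`n²/2` edges, room for them requires `n` just above `2√2 k`. -/
theorem exists_not_embedsInDecomposition_of_two_pow {c ε : ℝ} (hε : 0 < ε) (hε' : ε ≤ 1 / 4)
    (hc : c ≤ 6 - 2 * Real.sqrt 2 - ε) {w k m : ℕ} (hw : 16 / ε ≤ w) (hk : k = 2 ^ m)
    (hkw : (4 * w + 200) / ε ≤ k) :
    ∃ n : ℕ, 1 ≤ n ∧ ∃ D : Set (StarCopy (Fin n) k), IsPartialStarDecomposition ⊤ D ∧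
      ∀ s : ℕ, (s : ℝ) < c * k → ¬ EmbedsInDecomposition D s := by
  have hsq : Real.sqrt 2 * Real.sqrt 2 = 2 := Real.mul_self_sqrt (by norm_num)
  have hlt : Real.sqrt 2 < 3 / 2 := by
    rw [Real.sqrt_lt' (by norm_num)]; norm_num
  have hgt : 7 / 5 < Real.sqrt 2 := by
    rw [Real.lt_sqrt (by norm_num)]; norm_num
  set q := Real.sqrt 2 with hq
  rw [div_le_iff₀ hε] at hkw hw
  have hw0 : (0 : ℝ) < w := by
    by_contra! h
    nlinarith
  have hkpos : 0 < k := by rw [hk]; positivity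
  have hk0 : (0 : ℝ) < k := by exact_mod_cast hkpos
  have hεk : ε * k ≤ 1 / 4 * k := mul_le_mul_of_nonneg_right hε' hk0.le
  have hqk1 : 7 / 5 * k ≤ q * k := mul_le_mul_of_nonneg_right hgt.le hk0.le
  have hqk2 : q * k ≤ 3 / 2 * k := mul_le_mul_of_nonneg_right hlt.le hk0.le
  obtain ⟨n, hn1, hn2⟩ : ∃ n : ℕ, (n : ℝ) ≤ (2 * q + ε) * k ∧ (2 * q + ε) * k < n + 1 :=
    ⟨_, Nat.floor_le (by positivity), Nat.lt_floor_add_one _⟩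
  obtain ⟨d, hd1, hd2⟩ : ∃ d : ℕ, (4 + ε) * k ≤ d ∧ (d : ℝ) < (4 + ε) * k + 1 :=
    ⟨_, Nat.le_ceil _, Nat.ceil_lt_add_one (by positivity)⟩
  have hn0 : (1 : ℝ) ≤ n := by linarith
  have hnd : n ≤ d := by
    have : (n : ℝ) ≤ d := by linarith
    exact_mod_cast this
  obtain ⟨b, rfl⟩ := Nat.exists_eq_add_of_le hnd
  push_cast at hd1 hd2
  have hbn : (b : ℝ) ≤ n := by linarith
  have h1 : (2 * k * (1 + 1) + 2 * w + b : ℝ) ≤ 2 * n + 1 := by linarith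
  have hn3 : (2 * q + ε / 2) * k ≤ n - 2 * w := by linarith
  have hn4 : (2 * q + ε / 2) * k ≤ n := by linarith
  have h2 : (2 * k * (1 * n + b) + n * (2 * w + n) : ℝ) ≤ n * (2 * n + 1) := by
    have e1 : (2 * q + ε / 2) * k * ((2 * q + ε / 2) * k) ≤ n * (n - 2 * w) :=
      mul_le_mul hn4 hn3 (by positivity) (by positivity)
    have e2 : (k : ℝ) * (n + b) ≤ k * ((4 + ε) * k + 1) :=
      mul_le_mul_of_nonneg_left hd2.le hk0.le
    have e3 : (q * q) * (k * k) = 2 * (k * k) := by rw [hsq]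
    have e4 : 7 / 5 * k * (ε * k) ≤ q * k * (ε * k) :=
      mul_le_mul_of_nonneg_right hqk1 (by positivity)
    have e5 : (200 : ℝ) * k ≤ ε * k * k := mul_le_mul_of_nonneg_right (by linarith) hk0.le
    have e6 : 0 ≤ ε * ε * (k * k) := by positivity
    linarith
  obtain ⟨D, hD, hDc, hA⟩ := exists_packing_avoiding_blocks (g := 1) hkpos
    (by exact_mod_cast hw0) (by exact_mod_cast hbn) (by exact_mod_cast h1) (by exact_mod_cast h2)
  have hn1' : 1 ≤ n := by exact_mod_cast hn0
  refine ⟨n, hn1', D, hD, fun s hs hemb => ?_⟩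
  obtain ⟨M, hM, hMle⟩ := hemb.exists_card hA
  have hlt : n + s < (2 + 1) * (2 * k) := by
    have : (n + s : ℝ) < (2 + 1) * (2 * k) := by
      have := mul_le_mul_of_nonneg_right hc hk0.le
      linarith
    exact_mod_cast this
  have hpp : IsPrimePow (2 * k) := by
    rw [hk, ← pow_succ']
    exact Nat.prime_two.isPrimePow.pow (Nat.succ_ne_zero m)
  have hle := le_of_isPrimePow_dvd hpp (by omega) ⟨M, by rw [← hM]; ring⟩ hlt
  have h3 := two_mul_le_of_card_eq (j := 4) hkpos hM (by omega) (by norm_num) (by omega)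
  have h4 : ((n / w : ℕ) : ℝ) ≤ n * (ε / 16) := by
    refine Nat.cast_div_le.trans ?_
    rw [div_le_iff₀ hw0]
    nlinarith
  have h5 : (n : ℝ) * (ε / 16) ≤ 4 * k * (ε / 16) :=
    mul_le_mul_of_nonneg_right (by linarith) (by positivity)
  have h6 : (2 * M : ℝ) ≤ 2 * (n + s) + 2 * (4 * k + 1) := by
    have : 2 * M ≤ 2 * (n + s) + 2 * (4 * k + 1) := by omega
    exact_mod_cast this
  have h7 : (n + s + (n + b) : ℝ) ≤ M + ((n / w : ℕ) : ℝ) + 2 := by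
    have : n + s + (n + b) ≤ M + n / w + 2 := by omega
    exact_mod_cast this
  linarith

theorem theorem1 :
    (∀ k n : ℕ, 2 ≤ k → 1 ≤ n → ∀ D : Set (StarCopy (Fin n) k),
      IsPartialStarDecomposition (⊤ : SimpleGraph (Fin n)) D →
        ∃ s : ℕ, (Odd k → (s : ℝ) < 9 / 4 * (k : ℝ)) ∧
          (Even k → (s : ℝ) < (6 - 2 * Real.sqrt 2) * (k : ℝ)) ∧
          EmbedsInDecomposition D s) ∧
    (∀ c : ℝ, c < 9 / 4 →
      {k : ℕ | 2 ≤ k ∧ Odd k ∧ ∃ n : ℕ, 1 ≤ n ∧ ∃ D : Set (StarCopy (Fin n) k),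
        IsPartialStarDecomposition (⊤ : SimpleGraph (Fin n)) D ∧
          ∀ s : ℕ, (s : ℝ) < c * (k : ℝ) → ¬ EmbedsInDecomposition D s}.Infinite) ∧
    (∀ c : ℝ, c < 6 - 2 * Real.sqrt 2 →
      {k : ℕ | 2 ≤ k ∧ Even k ∧ ∃ n : ℕ, 1 ≤ n ∧ ∃ D : Set (StarCopy (Fin n) k),
        IsPartialStarDecomposition (⊤ : SimpleGraph (Fin n)) D ∧
          ∀ s : ℕ, (s : ℝ) < c * (k : ℝ) → ¬ EmbedsInDecomposition D s}.Infinite) := by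
  refine ⟨?_, ?_, ?_⟩
  · intro k n hk hn D hD
    obtain ⟨D, rfl⟩ := (Set.toFinite D).exists_finset_coe
    rcases Nat.even_or_odd k with hk' | hk'
    · obtain ⟨s, hs, h⟩ := exists_embedsInDecomposition_of_even hk hn hD
      exact ⟨s, fun h' => absurd hk' (Nat.not_even_iff_odd.2 h'), fun _ => hs, h⟩
    · obtain ⟨s, hs, h⟩ := exists_embedsInDecomposition_of_odd hk hn hk' hD
      exact ⟨s, fun _ => hs, fun h' => absurd h' (Nat.not_even_iff_odd.2 hk'), h⟩
  · intro c hc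
    set ε := min (1 / 4) (9 / 4 - c) with hε
    have hε0 : 0 < ε := lt_min (by norm_num) (by linarith)
    have hεc : ε ≤ 9 / 4 - c := min_le_right _ _
    refine Set.infinite_of_forall_exists_gt fun a => ?_
    obtain ⟨k, hka, hk⟩ := Nat.exists_infinite_primes
      (a + 3 + ⌈(4 * (⌈16 / ε⌉₊ : ℝ) + 200) / ε⌉₊)
    refine ⟨k, ⟨hk.two_le, hk.odd_of_ne_two (by omega), ?_⟩, by omega⟩
    exact exists_not_embedsInDecomposition_of_prime hε0 (min_le_left _ _) (by linarith)
      (Nat.le_ceil _) hk ((Nat.le_ceil _).trans (Nat.cast_le.2 (by omega)))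
  · intro c hc
    set ε := min (1 / 4) (6 - 2 * Real.sqrt 2 - c) with hε
    have hε0 : 0 < ε := lt_min (by norm_num) (by linarith)
    have hεc : ε ≤ 6 - 2 * Real.sqrt 2 - c := min_le_right _ _
    refine Set.infinite_of_forall_exists_gt fun a => ?_
    set m := a + 3 + ⌈(4 * (⌈16 / ε⌉₊ : ℝ) + 200) / ε⌉₊ with hm
    have hka : m < 2 ^ m := Nat.lt_two_pow_self
    refine ⟨2 ^ m, ⟨by omega, (Nat.even_pow' (by omega)).2 even_two, ?_⟩, by omega⟩
    exact exists_not_embedsInDecomposition_of_two_pow hε0 (min_le_left _ _) (by linarith)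
      (Nat.le_ceil _) rfl ((Nat.le_ceil _).trans (Nat.cast_le.2 (by omega)))
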